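/- Fix constants $\gamma>0$, $A\ge 0$, $0<c_1\le c_2$, $0<b_1\le b_2$. Let $n,m,d$ be positive integers with $c_1d^{1/20}\le n\le c_2 d^{1/20}$ (that is, $n=\Theta(d^{1/20})$), $n\le d$ and $m\ge n$, and let $e_1,\dots,e_d$ be the standard basis of $\mathbb R^d$. **Data.** There are $2n$ classes and $n$ clients. For $i\in[n]$, a sample of class $2i-1$ (respectively $2i$) is distributed as $$x=e_i-\sum_{j\in[n],\,j\ne i}\tau q_je_j+\mu\xi\qquad\Bigl(\text{respectively } x=-e_i-\sum_{j\in[n],\,j\ne i}\tau q_je_j+\mu\xi\Bigr),$$ with $\tau=d^{1/5}$, $\mu=d^{-1/5}$, independent $q_j$ uniform on $\{-1,1\}$ and an independent $\xi\sim\mathcal N(0,I_d)$. Client $k$ holds a data set $D_k$ of $|D_k|\ge d^{2+\gamma}$ samples with given labels, of which at most $A\,d^{-4/5}|D_k|$ are outside the two classes $2k-1,2k$. All samples of all clients are independent, $|D|=\sum_k|D_k|$, and $b_1/n\le |D_k|/|D|\le b_2/n$ for every $k$. **Objectives.** For $w\in\mathbb R^{m\times d}$ let $$\mathcal L_k(w)=-\mathbb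 E\bigl[(wx+\zeta)^T(wx+\zeta')\bigr]+\tfrac12\|w^Tw\|_F^2,\qquad \mathcal L(w)=\sum_{k=1}^n\frac{|D_k|}{|D|}\mathcal L_k(w),$$ where in $\mathcal L_k$ the point $x$ is uniform on the sample $D_k$ and, independently of $x$, $(\zeta,\zeta')$ is a pair of integrable, mean-zero noise vectors in $\mathbb R^m$ (whose law may depend on $k$) with $\zeta^T\zeta'$ integrable. For $w\in\mathbb R^{m\times d}$ with row space $\mathcal S$, the representability vector of $w$ is $r(w)=(r_1,\dots,r_d)$ with $r_i=\|\Pi_{\mathcal S}e_i\|^2$, where $\Pi_{\mathcal S}$ is the orthogonal projection onto $\mathcal S$. Below, $\|\cdot\|$ of a matrix is the spectral norm. **Claim.** There are constants $0<a\le b$, $C>0$ and $d_0$, depending only on $\gamma,A,c_1,c_2,b_1,b_2$, such that for all $d\ge d_0$ the following holds. (1) For every client $k$, with probability at least $1-Cd^{-\gamma}$: for every minimizer $w_k^*$ of $\mathcal L_k$, every $\epsilon\in\mathbb R^{m\times d}$ and every $i\in[n]\setminus\{k\}$, the representability vector $r^k=r(w_k^*+\epsilon)$ satisfies $$\frac{d^{2/5}-Cd^{-2/5}+2e_i^T(w_k^*)^T\epsilon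 e_i+\|\epsilon e_i\|^2}{d^{2/5}+Cd^{-2/5}+\|2(w_k^*)^T\epsilon+\epsilon^T\epsilon\|}\le r_i^k\le 1 .$$ (2) $d^{2/5}-a\,d^{7/20}+Cd^{-1/20}>0$, and with probability at least $1-Cd^{-\gamma}$: for every minimizer $w^*$ of $\mathcal L$, every $\epsilon_1\in\mathbb R^{m\times d}$ and every $i\in[n]$, the representability vector $\bar r=r(w^*+\epsilon_1)$ satisfies $$\frac{d^{2/5}-b\,d^{7/20}-Cd^{-1/20}-Cd^{-2/5}+2e_i^T(w^*)^T\epsilon_1e_i+\|\epsilon_1e_i\|^2}{d^{2/5}-a\,d^{7/20}+Cd^{-1/20}+\|2(w^*)^T\epsilon_1+\epsilon_1^T\epsilon_1\|}\le\bar r_i\le 1 .$$ (If one of the events is not measurable, the claim is that its complement has outer probability at most $Cd^{-\gamma}$.) -/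

import Mathlib

open MeasureTheory ProbabilityTheory
open scoped Matrix InnerProductSpace

noncomputable section

namespace FedSSL

/-- The direction (in `[n]`) attached to a class. The `2 n` classes are numbered from `0`: the classes
`2 i` and `2 i + 1` (that is, the classes `2 k - 1` and `2 k` in counting from one) carry the features
`e_i` and `- e_i`. -/
def classDir {n : ℕ} (c : Fin (2 * n)) : Fin n := ⟨c.val / 2, by omega⟩

/-- The sign of the feature of a class. -/
def classSign {n : ℕ} (c : Fin (2 * n)) : ℝ := (-1) ^ (c.val % 2)

/-- The standard basis vector `e_i` of `ℝ^d`, for `i` one of the first `n` indices. -/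
def basisVec {n d : ℕ} (h : n ≤ d) (i : Fin n) : EuclideanSpace ℝ (Fin d) :=
  EuclideanSpace.single (Fin.castLE h i) (1 : ℝ)

/-- The uniform law on `{-1, 1}`. -/
def signLaw : Measure ℝ :=
  ENNReal.ofReal (1 / 2) • Measure.dirac (1 : ℝ) + ENNReal.ofReal (1 / 2) • Measure.dirac (-1 : ℝ)

/-- A data point of class `c`, as a function of the nuisance coefficients `q` and the noise `ξ`:
`± e_i - ∑_{j ≠ i} τ q_j e_j + μ ξ` with `i` the direction of `c`, `τ = d^{1/5}`, `μ = d^{-1/5}`. -/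
def classPoint {n d : ℕ} (h : n ≤ d) (c : Fin (2 * n)) (p : (Fin n → ℝ) × (Fin d → ℝ)) :
    EuclideanSpace ℝ (Fin d) :=
  classSign c • basisVec h (classDir c)
    - ∑ j ∈ Finset.univ.erase (classDir c), ((d : ℝ) ^ (1 / 5 : ℝ) * p.1 j) • basisVec h j
    + (d : ℝ) ^ (-(1 / 5) : ℝ) • WithLp.toLp 2 p.2

/-- The law of a data point of class `c`: independent fair signs `q_j` and independent standard
Gaussian noise `ξ`. -/
def classLaw {n d : ℕ} (h : n ≤ d) (c : Fin (2 * n)) : Measure (EuclideanSpace ℝ (Fin d)) :=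
  ((Measure.pi fun _ : Fin n => signLaw).prod (Measure.pi fun _ : Fin d => gaussianReal 0 1)).map
    (classPoint h c)

/-- The number of samples of a client with labels `y` that are not of the two classes of
direction `k`. -/
def offClassCount {n N : ℕ} (k : Fin n) (y : Fin N → Fin (2 * n)) : ℕ :=
  (Finset.univ.filter fun s => classDir (y s) ≠ k).card

/-- A pair `(ξ, ξ')` of centered random noise vectors in the feature space, given by its law. -/
structure IsCenteredNoise {m : ℕ}
    (π : Measure (EuclideanSpace ℝ (Fin m) × EuclideanSpace ℝ (Fin m))) : Prop where
  prob : IsProbabilityMeasure π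
  integrable_fst : Integrable (fun p => p.1) π
  integrable_snd : Integrable (fun p => p.2) π
  mean_fst : ∫ p, p.1 ∂π = 0
  mean_snd : ∫ p, p.2 ∂π = 0
  integrable_inner : Integrable (fun p => ⟪p.1, p.2⟫_ℝ) π

/-- The squared Frobenius norm. -/
def frobSq {d : ℕ} (M : Matrix (Fin d) (Fin d) ℝ) : ℝ := ∑ i, ∑ j, M i j ^ 2

/-- The spectral (`ℓ²` operator) norm. -/
def specNorm {d : ℕ} (M : Matrix (Fin d) (Fin d) ℝ) : ℝ :=
  ‖Matrix.toEuclideanCLM (n := Fin d) (𝕜 := ℝ) M‖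

/-- The local objective
`- E [(w x + ξ)ᵀ (w x + ξ')] + 1/2 ‖wᵀ w‖_F²`, where `x` is drawn uniformly from the
local data set and `(ξ, ξ')` has law `π`. -/
def localLoss {m d N : ℕ} (π : Measure (EuclideanSpace ℝ (Fin m) × EuclideanSpace ℝ (Fin m)))
    (x : Fin N → EuclideanSpace ℝ (Fin d)) (w : Matrix (Fin m) (Fin d) ℝ) : ℝ :=
  -((1 / (N : ℝ)) * ∑ s, ∫ p, ⟪Matrix.toEuclideanLin w (x s) + p.1,
      Matrix.toEuclideanLin w (x s) + p.2⟫_ℝ ∂π)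
    + (1 / 2) * frobSq (wᵀ * w)

/-- The global objective, the average of the local ones with weights `|D_k| / |D|`. -/
def globalLoss {m d n : ℕ} {N : Fin n → ℕ}
    (π : Fin n → Measure (EuclideanSpace ℝ (Fin m) × EuclideanSpace ℝ (Fin m)))
    (x : (k : Fin n) → Fin (N k) → EuclideanSpace ℝ (Fin d)) (w : Matrix (Fin m) (Fin d) ℝ) : ℝ :=
  ∑ k, ((N k : ℝ) / ∑ l, (N l : ℝ)) * localLoss (π k) (x k) w

/-- `w` is a global minimizer of `L`. -/
def IsOptimal {m d : ℕ} (L : Matrix (Fin m) (Fin d) ℝ → ℝ) (w : Matrix (Fin m) (Fin d) ℝ) : Prop :=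
  ∀ v, L w ≤ L v

/-- The representability `r_i = ‖Π_S e_i‖²`, with `S` the span of the rows of `w`. -/
def representability {m d : ℕ} (w : Matrix (Fin m) (Fin d) ℝ) (i : Fin d) : ℝ :=
  ‖(Submodule.span ℝ (Set.range fun l : Fin m => (WithLp.toLp 2 (w l) : EuclideanSpace ℝ (Fin d)))
    ).starProjection (EuclideanSpace.single i (1 : ℝ))‖ ^ 2

/-- The perturbation `2 e_jᵀ wᵀ ε e_j + ‖ε e_j‖²`. -/
def diagPerturbation {m d : ℕ} (w ε : Matrix (Fin m) (Fin d) ℝ) (j : Fin d) : ℝ :=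
  2 * (wᵀ * ε) j j + ∑ l, ε l j ^ 2

/-- The perturbation `‖2 wᵀ ε + εᵀ ε‖`. -/
def normPerturbation {m d : ℕ} (w ε : Matrix (Fin m) (Fin d) ℝ) : ℝ :=
  specNorm ((2 : ℝ) • (wᵀ * ε) + εᵀ * ε)

end FedSSL

end

/-
For a centred noise law, `𝓛_k` is `-tr(w X wᵀ) + ‖wᵀ w‖_F² / 2` up to a constant, with `X` the
empirical second moment matrix, so `wᵀ w` is a best approximation of `X` by positive semidefinite
matrices of rank at most `m`. The expectation of `X` is diagonal; its `j`-th entry is `τ² + μ²`,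
lowered by `τ² - 1` times the fraction of samples in the two classes of direction `j`. Fourth
moments and Chebyshev's inequality put `X` within `μ²` of it, and then `wᵀ w` too is diagonal up to
`O(μ²)` in the feature directions. Finally `‖w e_i‖² ≤ ‖wᵀ w‖ ‖Π e_i‖²` for every matrix `w`, so a
large diagonal entry of the Gram matrix relative to its norm makes `e_i` well represented, and this
is stable under perturbations of `w`. For the global model, each direction carries a fraction
`Θ(1/n) = Θ(d^{-1/20})` of the pooled data, which lowers `τ²` by the terms of order `d^{7/20}`.
-/

noncomputable section

namespace FedSSL

section LocalMinimizers

open Filter Topology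

variable {κ ι : Type*} [Fintype κ] [Fintype ι]

/-- The contrastive objective as a function of the second moment matrix `X` of the data:
`-tr (X wᵀ w) + 1/2 ‖wᵀ w‖_F²`. -/
def gramLoss (X : Matrix ι ι ℝ) (w : Matrix κ ι ℝ) : ℝ :=
  -(X * (wᵀ * w)).trace + (1 / 2) * ((wᵀ * w) * (wᵀ * w)).trace

theorem quartic_coeff_of_eventually_nonneg {a b c e : ℝ}
    (h : ∀ᶠ t in 𝓝 (0 : ℝ), 0 ≤ a * t + b * t ^ 2 + c * t ^ 3 + e * t ^ 4) : a = 0 ∧ 0 ≤ b := by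
  have ha : a = 0 := by
    have hderiv : HasDerivAt (fun t : ℝ => a * t + b * t ^ 2 + c * t ^ 3 + e * t ^ 4) a 0 := by
      have hsum := ((((hasDerivAt_id (0 : ℝ)).const_mul a).add
        ((hasDerivAt_pow 2 (0 : ℝ)).const_mul b)).add
        ((hasDerivAt_pow 3 (0 : ℝ)).const_mul c)).add ((hasDerivAt_pow 4 (0 : ℝ)).const_mul e)
      convert! hsum using 1
      simp
    have hmin : IsLocalMin (fun t : ℝ => a * t + b * t ^ 2 + c * t ^ 3 + e * t ^ 4) 0 := by
      simpa [IsLocalMin, IsMinFilter] using h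
    exact hmin.hasDerivAt_eq_zero hderiv
  have hlim : Tendsto (fun t : ℝ => b + c * t + e * t ^ 2) (𝓝[≠] 0) (𝓝 b) := by
    have hcont : Continuous fun t : ℝ => b + c * t + e * t ^ 2 := by fun_prop
    simpa using (hcont.tendsto 0).mono_left nhdsWithin_le_nhds
  refine ⟨ha, ge_of_tendsto hlim ?_⟩
  filter_upwards [h.filter_mono nhdsWithin_le_nhds, self_mem_nhdsWithin] with t ht ht0
  have hfactor : a * t + b * t ^ 2 + c * t ^ 3 + e * t ^ 4
      = t ^ 2 * (b + c * t + e * t ^ 2) := by rw [ha]; ring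
  rw [hfactor] at ht
  exact nonneg_of_mul_nonneg_right ht (sq_pos_of_ne_zero ht0)

theorem gramLoss_add_smul (X : Matrix ι ι ℝ) (w v : Matrix κ ι ℝ) (t : ℝ) :
    gramLoss X (w + t • v) = gramLoss X w
      + ((wᵀ * w - X) * (wᵀ * v + vᵀ * w)).trace * t
      + (((wᵀ * w - X) * (vᵀ * v)).trace
        + (1 / 2) * ((wᵀ * v + vᵀ * w) * (wᵀ * v + vᵀ * w)).trace) * t ^ 2
      + ((wᵀ * v + vᵀ * w) * (vᵀ * v)).trace * t ^ 3
      + ((1 / 2) * ((vᵀ * v) * (vᵀ * v)).trace) * t ^ 4 := by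
  have hgram : (w + t • v)ᵀ * (w + t • v)
      = wᵀ * w + t • (wᵀ * v + vᵀ * w) + t ^ 2 • (vᵀ * v) := by
    simp only [Matrix.transpose_add, Matrix.transpose_smul, Matrix.add_mul, Matrix.mul_add,
      Matrix.smul_mul, Matrix.mul_smul, smul_add, smul_smul, pow_two]
    abel
  rw [gramLoss, gramLoss, hgram]
  generalize wᵀ * w = G, wᵀ * v + vᵀ * w = H, vᵀ * v = K
  simp only [Matrix.add_mul, Matrix.mul_add, Matrix.sub_mul, Matrix.smul_mul, Matrix.mul_smul,
    Matrix.trace_add, Matrix.trace_sub, Matrix.trace_smul, smul_eq_mul]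
  rw [Matrix.trace_mul_comm H G, Matrix.trace_mul_comm K G, Matrix.trace_mul_comm K H]
  ring

variable {X : Matrix ι ι ℝ} {w : Matrix κ ι ℝ}

theorem variations_of_isLocalMin_gramLoss (hw : IsLocalMin (gramLoss X) w) (v : Matrix κ ι ℝ) :
    ((wᵀ * w - X) * (wᵀ * v + vᵀ * w)).trace = 0 ∧
      0 ≤ ((wᵀ * w - X) * (vᵀ * v)).trace
        + (1 / 2) * ((wᵀ * v + vᵀ * w) * (wᵀ * v + vᵀ * w)).trace := by
  have hcont : Continuous fun t : ℝ => w + t • v := by fun_prop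
  have hline : ∀ᶠ t in 𝓝 (0 : ℝ), gramLoss X w ≤ gramLoss X (w + t • v) :=
    (by simpa using hcont.tendsto 0 : Tendsto _ _ (𝓝 w)).eventually hw
  refine quartic_coeff_of_eventually_nonneg
    (c := ((wᵀ * v + vᵀ * w) * (vᵀ * v)).trace) (e := (1 / 2) * ((vᵀ * v) * (vᵀ * v)).trace) ?_
  filter_upwards [hline] with t ht
  rw [gramLoss_add_smul] at ht
  linarith

theorem mul_eq_mul_gram_of_isLocalMin (hX : Xᵀ = X) (hw : IsLocalMin (gramLoss X) w) :
    w * X = w * (wᵀ * w) := by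
  set R := wᵀ * w - X with hR
  have hRt : Rᵀ = R := by simp [hR, hX]
  have hzero : (R * (wᵀ * (w * R) + (w * R)ᵀ * w)).trace = 0 :=
    (variations_of_isLocalMin_gramLoss hw (w * R)).1
  have hsq : (R * (wᵀ * (w * R) + (w * R)ᵀ * w)).trace = 2 * (w * R * (w * R)ᵀ).trace := by
    have hleft : (R * (wᵀ * (w * R))).trace = (w * R * (w * R)ᵀ).trace := by
      rw [Matrix.transpose_mul, hRt, ← Matrix.mul_assoc, Matrix.trace_mul_comm]
    have hright : (R * ((w * R)ᵀ * w)).trace = (w * R * (w * R)ᵀ).trace := by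
      rw [Matrix.trace_mul_comm, Matrix.mul_assoc, Matrix.trace_mul_comm]
    rw [Matrix.mul_add, Matrix.trace_add, hleft, hright]
    ring
  have hwR : w * R = 0 := by
    rw [← Matrix.trace_mul_conjTranspose_self_eq_zero_iff,
      Matrix.conjTranspose_eq_transpose_of_trivial]
    linarith
  rw [hR, Matrix.mul_sub, sub_eq_zero] at hwR
  exact hwR.symm

theorem transpose_mulVec_dotProduct (w : Matrix κ ι ℝ) (α : κ → ℝ) (u : ι → ℝ) :
    (wᵀ *ᵥ α) ⬝ᵥ u = α ⬝ᵥ w *ᵥ u := by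
  rw [Matrix.dotProduct_mulVec, Matrix.mulVec_transpose]

theorem trace_mul_vecMulVec (M : Matrix ι ι ℝ) (u v : ι → ℝ) :
    (M * Matrix.vecMulVec u v).trace = v ⬝ᵥ M *ᵥ u := by
  rw [Matrix.mul_vecMulVec, Matrix.trace_vecMulVec, dotProduct_comm]

theorem dotProduct_mulVec_le_of_mulVec_eq_zero (hw : IsLocalMin (gramLoss X) w) (α : κ → ℝ)
    {u : ι → ℝ} (hu : w *ᵥ u = 0) :
    (α ⬝ᵥ α) * (u ⬝ᵥ X *ᵥ u) ≤ ((wᵀ *ᵥ α) ⬝ᵥ (wᵀ *ᵥ α)) * (u ⬝ᵥ u) := by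
  set β := wᵀ *ᵥ α with hβ
  have hβu : β ⬝ᵥ u = 0 := by rw [hβ, transpose_mulVec_dotProduct, hu, dotProduct_zero]
  have hsecond := (variations_of_isLocalMin_gramLoss hw (Matrix.vecMulVec α u)).2
  have hH : wᵀ * Matrix.vecMulVec α u + (Matrix.vecMulVec α u)ᵀ * w
      = Matrix.vecMulVec β u + Matrix.vecMulVec u β := by
    rw [Matrix.transpose_vecMulVec, Matrix.mul_vecMulVec, Matrix.vecMulVec_mul, hβ,
      Matrix.mulVec_transpose]
  have hK : (Matrix.vecMulVec α u)ᵀ * Matrix.vecMulVec α u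
      = (α ⬝ᵥ α) • Matrix.vecMulVec u u := by
    rw [Matrix.transpose_vecMulVec, Matrix.vecMulVec_mul_vecMulVec, Matrix.vecMulVec_smul]
  have htraceK : ((wᵀ * w - X) * Matrix.vecMulVec u u).trace = -(u ⬝ᵥ X *ᵥ u) := by
    rw [trace_mul_vecMulVec, Matrix.sub_mulVec, ← Matrix.mulVec_mulVec, hu, Matrix.mulVec_zero,
      zero_sub, dotProduct_neg]
  have htraceH : ((Matrix.vecMulVec β u + Matrix.vecMulVec u β)
      * (Matrix.vecMulVec β u + Matrix.vecMulVec u β)).trace = 2 * ((β ⬝ᵥ β) * (u ⬝ᵥ u)) := by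
    have huβ : u ⬝ᵥ β = 0 := by rw [dotProduct_comm, hβu]
    simp only [Matrix.add_mul, Matrix.mul_add, Matrix.vecMulVec_mul_vecMulVec,
      Matrix.trace_add, Matrix.trace_vecMulVec, dotProduct_smul, smul_eq_mul, hβu, huβ]
    ring
  rw [hH, hK, Matrix.mul_smul, Matrix.trace_smul, htraceK, htraceH, smul_eq_mul] at hsecond
  linarith

theorem mulVec_range_of_isLocalMin (hX : Xᵀ = X) (hw : IsLocalMin (gramLoss X) w) (z : κ → ℝ) :
    X *ᵥ (wᵀ *ᵥ z) = (wᵀ * w) *ᵥ (wᵀ *ᵥ z) := by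
  have htranspose : X * wᵀ = wᵀ * w * wᵀ := by
    simpa [hX, Matrix.mul_assoc] using
      congrArg Matrix.transpose (mul_eq_mul_gram_of_isLocalMin hX hw)
  rw [Matrix.mulVec_mulVec, htranspose, ← Matrix.mulVec_mulVec]

theorem dotProduct_gram_mulVec (w : Matrix κ ι ℝ) (u v : ι → ℝ) :
    u ⬝ᵥ (wᵀ * w) *ᵥ v = (w *ᵥ u) ⬝ᵥ (w *ᵥ v) := by
  rw [← Matrix.mulVec_mulVec, dotProduct_comm, transpose_mulVec_dotProduct, dotProduct_comm]

theorem dotProduct_mulVec_add_of_isLocalMin (hX : Xᵀ = X) (hw : IsLocalMin (gramLoss X) w)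
    (z : κ → ℝ) {u : ι → ℝ} (hu : w *ᵥ u = 0) :
    (wᵀ *ᵥ z + u) ⬝ᵥ X *ᵥ (wᵀ *ᵥ z + u)
      = (w *ᵥ (wᵀ *ᵥ z)) ⬝ᵥ (w *ᵥ (wᵀ *ᵥ z)) + u ⬝ᵥ X *ᵥ u := by
  have hcross : u ⬝ᵥ X *ᵥ (wᵀ *ᵥ z) = 0 := by
    rw [mulVec_range_of_isLocalMin hX hw, dotProduct_gram_mulVec, hu, zero_dotProduct]
  have hcross' : (wᵀ *ᵥ z) ⬝ᵥ X *ᵥ u = 0 := by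
    rw [← transpose_mulVec_dotProduct, hX, dotProduct_comm, hcross]
  rw [Matrix.mulVec_add, add_dotProduct, dotProduct_add, dotProduct_add, hcross, hcross',
    mulVec_range_of_isLocalMin hX hw, dotProduct_gram_mulVec]
  ring

theorem dotProduct_self_add_of_mulVec_eq_zero (z : κ → ℝ) {u : ι → ℝ} (hu : w *ᵥ u = 0) :
    (wᵀ *ᵥ z + u) ⬝ᵥ (wᵀ *ᵥ z + u) = (wᵀ *ᵥ z) ⬝ᵥ (wᵀ *ᵥ z) + u ⬝ᵥ u := by
  have horth : (wᵀ *ᵥ z) ⬝ᵥ u = 0 := by rw [transpose_mulVec_dotProduct, hu, dotProduct_zero]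
  simp [add_dotProduct, dotProduct_add, horth, dotProduct_comm u]

theorem dotProduct_self_real_nonneg (v : ι → ℝ) : 0 ≤ v ⬝ᵥ v :=
  Finset.sum_nonneg fun i _ => mul_self_nonneg (v i)

theorem mul_dotProduct_self_le_of_coercive {ρ : ℝ} (hρ : 0 ≤ ρ)
    (hcoer : ∀ α : κ → ℝ, ρ * (α ⬝ᵥ α) ≤ (wᵀ *ᵥ α) ⬝ᵥ (wᵀ *ᵥ α)) (z : κ → ℝ) :
    ρ * ((wᵀ *ᵥ z) ⬝ᵥ (wᵀ *ᵥ z)) ≤ (w *ᵥ (wᵀ *ᵥ z)) ⬝ᵥ (w *ᵥ (wᵀ *ᵥ z)) := by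
  set y := wᵀ *ᵥ z with hy
  rcases (dotProduct_self_real_nonneg y).eq_or_lt with hyy | hyy
  · rw [← hyy, mul_zero]
    exact dotProduct_self_real_nonneg _
  have hcauchy : (y ⬝ᵥ y) ^ 2 ≤ (z ⬝ᵥ z) * ((w *ᵥ y) ⬝ᵥ (w *ᵥ y)) := by
    rw [show y ⬝ᵥ y = z ⬝ᵥ w *ᵥ y by rw [hy, transpose_mulVec_dotProduct]]
    simpa [dotProduct, pow_two] using Finset.sum_mul_sq_le_sq_mul_sq Finset.univ z (w *ᵥ y)
  refine le_of_mul_le_mul_left ?_ hyy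
  calc (y ⬝ᵥ y) * (ρ * (y ⬝ᵥ y)) = ρ * (y ⬝ᵥ y) ^ 2 := by ring
    _ ≤ ρ * ((z ⬝ᵥ z) * ((w *ᵥ y) ⬝ᵥ (w *ᵥ y))) := by gcongr
    _ = ρ * (z ⬝ᵥ z) * ((w *ᵥ y) ⬝ᵥ (w *ᵥ y)) := by ring
    _ ≤ (y ⬝ᵥ y) * ((w *ᵥ y) ⬝ᵥ (w *ᵥ y)) := by
      gcongr
      exacts [dotProduct_self_real_nonneg _, hcoer z]

theorem exists_ne_zero_forall_mem_apply_eq_zero {ι : Type*} (w : Matrix κ ι ℝ) (u : ι → ℝ)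
    {s : Finset ι} (hs : s.card ≤ Fintype.card κ) :
    ∃ (z : κ → ℝ) (c : ℝ), (z ≠ 0 ∨ c ≠ 0) ∧ ∀ i ∈ s, (wᵀ *ᵥ z + c • u) i = 0 := by
  classical
  let T : ((κ → ℝ) × ℝ) →ₗ[ℝ] (s → ℝ) := LinearMap.funLeft ℝ ℝ (Subtype.val : s → ι) ∘ₗ
    (Matrix.toLin' wᵀ).coprod (LinearMap.toSpanSingleton ℝ (ι → ℝ) u)
  have hker : LinearMap.ker T ≠ ⊥ := by
    apply LinearMap.ker_ne_bot_of_finrank_lt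
    simp only [Module.finrank_prod, Module.finrank_fintype_fun_eq_card, Module.finrank_self,
      Fintype.card_coe]
    lia
  obtain ⟨⟨z, c⟩, hT, hne⟩ := Submodule.exists_mem_ne_zero_of_ne_bot hker
  refine ⟨z, c, ?_, fun i hi => ?_⟩
  · by_contra! h
    exact hne (Prod.ext h.1 h.2)
  · simpa [T, LinearMap.funLeft_apply] using congrFun (LinearMap.mem_ker.1 hT) ⟨i, hi⟩

theorem exists_eq_transpose_mulVec_add (w : Matrix κ ι ℝ) (v : ι → ℝ) :
    ∃ (z : κ → ℝ) (u : ι → ℝ), w *ᵥ u = 0 ∧ v = wᵀ *ᵥ z + u := by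
  classical
  let T := Matrix.toEuclideanLin w
  obtain ⟨u, hu, y, hy, hv⟩ := T.ker.exists_add_mem_mem_orthogonal (WithLp.toLp 2 v)
  rw [LinearMap.orthogonal_ker, ← Matrix.toEuclideanLin_conjTranspose_eq_adjoint,
    Matrix.conjTranspose_eq_transpose_of_trivial] at hy
  obtain ⟨z, rfl⟩ := hy
  refine ⟨z.ofLp, u.ofLp, congrArg WithLp.ofLp (LinearMap.mem_ker.1 hu), ?_⟩
  rw [add_comm]
  exact congrArg WithLp.ofLp hv

section CoordinateBound

variable {s : Finset ι} {η : ℝ}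

-- If the Rayleigh quotient `ρ` of `u` exceeded `η`, then `w wᵀ ≥ ρ` by the second variation, so `X`
-- would be `≥ ρ` on the span of `u` and the row space, which meets the vectors vanishing on `s`.
theorem dotProduct_mulVec_le_on_ker (hs : s.card ≤ Fintype.card κ) (hη : 0 ≤ η)
    (hXη : ∀ v : ι → ℝ, (∀ i ∈ s, v i = 0) → v ⬝ᵥ X *ᵥ v ≤ η * (v ⬝ᵥ v)) (hX : Xᵀ = X)
    (hw : IsLocalMin (gramLoss X) w) {u : ι → ℝ} (hu : w *ᵥ u = 0) :
    u ⬝ᵥ X *ᵥ u ≤ η * (u ⬝ᵥ u) := by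
  rcases (dotProduct_self_real_nonneg u).eq_or_lt with huu | huu
  · rw [dotProduct_self_eq_zero.1 huu.symm]
    simp
  by_contra! hlt
  set ρ := (u ⬝ᵥ X *ᵥ u) / (u ⬝ᵥ u)
  have hηρ : η < ρ := (lt_div_iff₀ huu).2 hlt
  have huX : u ⬝ᵥ X *ᵥ u = ρ * (u ⬝ᵥ u) := (div_mul_cancel₀ _ huu.ne').symm
  have hcoer : ∀ α : κ → ℝ, ρ * (α ⬝ᵥ α) ≤ (wᵀ *ᵥ α) ⬝ᵥ (wᵀ *ᵥ α) := fun α => by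
    have hsecond := dotProduct_mulVec_le_of_mulVec_eq_zero hw α hu
    rw [huX] at hsecond
    exact le_of_mul_le_mul_right (by linarith) huu
  obtain ⟨z, c, hne, hvanish⟩ := exists_ne_zero_forall_mem_apply_eq_zero w u hs
  have hcu : w *ᵥ (c • u) = 0 := by rw [Matrix.mulVec_smul, hu, smul_zero]
  have hupper := hXη _ hvanish
  rw [dotProduct_mulVec_add_of_isLocalMin hX hw z hcu,
    dotProduct_self_add_of_mulVec_eq_zero z hcu] at hupper
  simp only [Matrix.mulVec_smul, smul_dotProduct, dotProduct_smul, smul_eq_mul, huX] at hupper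
  have hrange := mul_dotProduct_self_le_of_coercive (hη.trans hηρ.le) hcoer z
  have hyy := dotProduct_self_real_nonneg (wᵀ *ᵥ z)
  have hcc : 0 ≤ c ^ 2 * (u ⬝ᵥ u) := mul_nonneg (sq_nonneg c) huu.le
  have hnorm : (wᵀ *ᵥ z) ⬝ᵥ (wᵀ *ᵥ z) + c ^ 2 * (u ⬝ᵥ u) ≤ 0 := by nlinarith
  have hc : c = 0 := by
    by_contra hc
    have : 0 < c ^ 2 * (u ⬝ᵥ u) := mul_pos (sq_pos_of_ne_zero hc) huu
    linarith
  have hz : z = 0 := by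
    have hzz := hcoer z
    have : z ⬝ᵥ z ≤ 0 := by nlinarith
    exact dotProduct_self_eq_zero.1 (this.antisymm (dotProduct_self_real_nonneg z))
  exact hne.elim (· hz) (· hc)

theorem dotProduct_mulVec_le_gram_add (hs : s.card ≤ Fintype.card κ) (hη : 0 ≤ η)
    (hXη : ∀ v : ι → ℝ, (∀ i ∈ s, v i = 0) → v ⬝ᵥ X *ᵥ v ≤ η * (v ⬝ᵥ v)) (hX : Xᵀ = X)
    (hw : IsLocalMin (gramLoss X) w) (v : ι → ℝ) :
    v ⬝ᵥ X *ᵥ v ≤ v ⬝ᵥ (wᵀ * w) *ᵥ v + η * (v ⬝ᵥ v) := by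
  obtain ⟨z, u, hu, rfl⟩ := exists_eq_transpose_mulVec_add w v
  rw [dotProduct_mulVec_add_of_isLocalMin hX hw z hu, dotProduct_gram_mulVec, Matrix.mulVec_add,
    hu, add_zero, dotProduct_self_add_of_mulVec_eq_zero z hu]
  have hker := dotProduct_mulVec_le_on_ker hs hη hXη hX hw hu
  have hrange := mul_nonneg hη (dotProduct_self_real_nonneg (wᵀ *ᵥ z))
  linarith

theorem diag_le_gram_diag_add (hs : s.card ≤ Fintype.card κ) (hη : 0 ≤ η)
    (hXη : ∀ v : ι → ℝ, (∀ i ∈ s, v i = 0) → v ⬝ᵥ X *ᵥ v ≤ η * (v ⬝ᵥ v)) (hX : Xᵀ = X)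
    (hw : IsLocalMin (gramLoss X) w) (i : ι) : X i i ≤ (wᵀ * w) i i + η := by
  classical
  simpa using dotProduct_mulVec_le_gram_add hs hη hXη hX hw (Pi.single i 1)

end CoordinateBound

theorem dotProduct_ofLp_self (y : EuclideanSpace ℝ ι) : y.ofLp ⬝ᵥ y.ofLp = ‖y‖ ^ 2 := by
  rw [EuclideanSpace.real_norm_sq_eq]
  simp [dotProduct, pow_two]

section SpectralNorm

open scoped Matrix.Norms.L2Operator

variable [DecidableEq ι]

theorem sq_norm_le_sum_sq (M : Matrix κ ι ℝ) : ‖M‖ ^ 2 ≤ ∑ i, ∑ j, M i j ^ 2 := by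
  have hM : 0 ≤ ∑ i, ∑ j, M i j ^ 2 := by positivity
  rw [← Real.le_sqrt (norm_nonneg M) hM, Matrix.l2_opNorm_def]
  refine ContinuousLinearMap.opNorm_le_bound _ (Real.sqrt_nonneg _) fun v => ?_
  refine le_of_sq_le_sq ?_ (by positivity)
  rw [mul_pow, Real.sq_sqrt hM, EuclideanSpace.real_norm_sq_eq, EuclideanSpace.real_norm_sq_eq,
    Finset.sum_mul]
  refine Finset.sum_le_sum fun i _ => ?_
  exact Finset.sum_mul_sq_le_sq_mul_sq _ _ _

theorem dotProduct_mulVec_le_norm (M : Matrix ι ι ℝ) (v : ι → ℝ) :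
    v ⬝ᵥ M *ᵥ v ≤ ‖M‖ * (v ⬝ᵥ v) := by
  have hnorm : v ⬝ᵥ v = ‖(WithLp.toLp 2 v : EuclideanSpace ℝ ι)‖ ^ 2 := dotProduct_ofLp_self _
  calc v ⬝ᵥ M *ᵥ v
      = ⟪WithLp.toLp 2 v, Matrix.toEuclideanCLM (𝕜 := ℝ) M (WithLp.toLp 2 v)⟫_ℝ :=
        (Matrix.inner_toEuclideanCLM M _ _).symm
    _ ≤ ‖(WithLp.toLp 2 v : EuclideanSpace ℝ ι)‖
          * ‖Matrix.toEuclideanCLM (𝕜 := ℝ) M (WithLp.toLp 2 v)‖ := real_inner_le_norm _ _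
    _ ≤ ‖(WithLp.toLp 2 v : EuclideanSpace ℝ ι)‖
          * (‖M‖ * ‖(WithLp.toLp 2 v : EuclideanSpace ℝ ι)‖) := by
        gcongr
        exact ContinuousLinearMap.le_opNorm _ _
    _ = ‖M‖ * (v ⬝ᵥ v) := by rw [hnorm]; ring

theorem diag_le_norm (M : Matrix ι ι ℝ) (i : ι) : M i i ≤ ‖M‖ := by
  simpa using dotProduct_mulVec_le_norm M (Pi.single i 1)

theorem norm_gram_le (hX : Xᵀ = X) (hw : IsLocalMin (gramLoss X) w) : ‖wᵀ * w‖ ≤ ‖X‖ := by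
  have hsq : ‖wᵀ * w‖ * ‖wᵀ * w‖ ≤ ‖wᵀ * w‖ * ‖X‖ :=
    calc ‖wᵀ * w‖ * ‖wᵀ * w‖ = ‖(wᵀ * w)ᵀ * (wᵀ * w)‖ := by
          rw [← Matrix.conjTranspose_eq_transpose_of_trivial (wᵀ * w),
            Matrix.l2_opNorm_conjTranspose_mul_self]
      _ = ‖wᵀ * w * X‖ := by
          rw [Matrix.mul_assoc wᵀ w X, mul_eq_mul_gram_of_isLocalMin hX hw]
          simp [Matrix.mul_assoc]
      _ ≤ ‖wᵀ * w‖ * ‖X‖ := Matrix.l2_opNorm_mul _ _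
  rcases (norm_nonneg (wᵀ * w)).eq_or_lt with h | h
  · exact h ▸ norm_nonneg X
  · exact le_of_mul_le_mul_left hsq h

theorem norm_gram_le_norm_add_norm_sub (hX : Xᵀ = X) (hw : IsLocalMin (gramLoss X) w)
    (D : ι → ℝ) : ‖wᵀ * w‖ ≤ ‖D‖ + ‖X - Matrix.diagonal D‖ := by
  rw [← Matrix.l2_opNorm_diagonal]
  exact (norm_gram_le hX hw).trans (norm_le_norm_add_norm_sub' _ _)

theorem le_gram_diag_add_norm_sub {s : Finset ι} (hs : s.card ≤ Fintype.card κ) {D : ι → ℝ} {η : ℝ}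
    (hη : 0 ≤ η) (hD : ∀ i ∉ s, D i ≤ η) (hX : Xᵀ = X) (hw : IsLocalMin (gramLoss X) w) (i : ι) :
    D i ≤ (wᵀ * w) i i + η + 2 * ‖X - Matrix.diagonal D‖ := by
  have hentry : D i ≤ X i i + ‖X - Matrix.diagonal D‖ := by
    have := diag_le_norm (Matrix.diagonal D - X) i
    rw [Matrix.sub_apply, Matrix.diagonal_apply_eq, norm_sub_rev] at this
    linarith
  have hquad : ∀ v : ι → ℝ, (∀ i ∈ s, v i = 0) →
      v ⬝ᵥ X *ᵥ v ≤ (η + ‖X - Matrix.diagonal D‖) * (v ⬝ᵥ v) := fun v hv => by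
    have hdiag : v ⬝ᵥ Matrix.diagonal D *ᵥ v ≤ η * (v ⬝ᵥ v) := by
      simp only [dotProduct, Matrix.mulVec_diagonal, Finset.mul_sum]
      refine Finset.sum_le_sum fun j _ => ?_
      by_cases hj : j ∈ s
      · simp [hv j hj]
      · nlinarith [mul_le_mul_of_nonneg_right (hD j hj) (mul_self_nonneg (v j))]
    have hrest := dotProduct_mulVec_le_norm (X - Matrix.diagonal D) v
    rw [Matrix.sub_mulVec, dotProduct_sub] at hrest
    linarith
  have := diag_le_gram_diag_add hs (add_nonneg hη (norm_nonneg _)) hquad hX hw i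
  linarith

end SpectralNorm

end LocalMinimizers

section Representability

open scoped Matrix.Norms.L2Operator

variable {m d : ℕ}

theorem representability_le_one (v : Matrix (Fin m) (Fin d) ℝ) (i : Fin d) :
    representability v i ≤ 1 := by
  refine pow_le_one₀ (norm_nonneg _) ((Submodule.norm_starProjection_apply_le _ _).trans ?_)
  simp

theorem mulVec_starProjection_rowSpan (v : Matrix (Fin m) (Fin d) ℝ)
    (y : EuclideanSpace ℝ (Fin d)) :
    v *ᵥ ((Submodule.span ℝ (Set.range fun l : Fin m =>
      (WithLp.toLp 2 (v l) : EuclideanSpace ℝ (Fin d)))).starProjection y).ofLp = v *ᵥ y.ofLp := by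
  ext l
  have hrow : ∀ z : EuclideanSpace ℝ (Fin d), (v *ᵥ z.ofLp) l
      = ⟪(WithLp.toLp 2 (v l) : EuclideanSpace ℝ (Fin d)), z⟫_ℝ := fun z => by
    simp [PiLp.inner_apply, Matrix.mulVec, dotProduct, mul_comm]
  rw [hrow, hrow, ← Submodule.inner_starProjection_left_eq_right,
    Submodule.starProjection_eq_self_iff.2 (Submodule.subset_span (Set.mem_range_self l))]

theorem gram_diag_le_norm_mul_representability (v : Matrix (Fin m) (Fin d) ℝ) (i : Fin d) :
    (vᵀ * v) i i ≤ ‖vᵀ * v‖ * representability v i := by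
  unfold representability
  set y := (Submodule.span ℝ (Set.range fun l : Fin m =>
    (WithLp.toLp 2 (v l) : EuclideanSpace ℝ (Fin d)))).starProjection
      (EuclideanSpace.single i (1 : ℝ))
  have hvy : v *ᵥ y.ofLp = v *ᵥ Pi.single i 1 := mulVec_starProjection_rowSpan v _
  calc (vᵀ * v) i i = Pi.single i 1 ⬝ᵥ (vᵀ * v) *ᵥ Pi.single i 1 := by simp
    _ = y.ofLp ⬝ᵥ (vᵀ * v) *ᵥ y.ofLp := by
        rw [dotProduct_gram_mulVec, dotProduct_gram_mulVec, hvy]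
    _ ≤ ‖vᵀ * v‖ * (y.ofLp ⬝ᵥ y.ofLp) := dotProduct_mulVec_le_norm _ _
    _ = ‖vᵀ * v‖ * ‖y‖ ^ 2 := by rw [dotProduct_ofLp_self]

theorem gram_add_diag (w ε : Matrix (Fin m) (Fin d) ℝ) (i : Fin d) :
    ((w + ε)ᵀ * (w + ε)) i i = (wᵀ * w) i i + diagPerturbation w ε i := by
  simp only [diagPerturbation, Matrix.mul_apply, Matrix.transpose_apply, Matrix.add_apply,
    Finset.mul_sum, ← Finset.sum_add_distrib]
  exact Finset.sum_congr rfl fun l _ => by ring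

theorem norm_gram_add_le (w ε : Matrix (Fin m) (Fin d) ℝ) :
    ‖(w + ε)ᵀ * (w + ε)‖ ≤ ‖wᵀ * w‖ + normPerturbation w ε := by
  set M := (2 : ℝ) • (wᵀ * ε) + εᵀ * ε with hM
  have hsymm : (w + ε)ᵀ * (w + ε) = wᵀ * w + (1 / 2 : ℝ) • (M + Mᵀ) := by
    simp only [hM, Matrix.transpose_add, Matrix.add_mul, Matrix.mul_add, Matrix.transpose_smul,
      Matrix.transpose_mul, Matrix.transpose_transpose]
    module
  have htranspose : ‖Mᵀ‖ = ‖M‖ := by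
    rw [← Matrix.conjTranspose_eq_transpose_of_trivial, Matrix.l2_opNorm_conjTranspose]
  calc ‖(w + ε)ᵀ * (w + ε)‖ ≤ ‖wᵀ * w‖ + ‖(1 / 2 : ℝ) • (M + Mᵀ)‖ := by
        rw [hsymm]; exact norm_add_le _ _
    _ ≤ ‖wᵀ * w‖ + 1 / 2 * (‖M‖ + ‖M‖) := by
        rw [norm_smul, Real.norm_of_nonneg (by norm_num : (0 : ℝ) ≤ 1 / 2)]
        gcongr
        exact (norm_add_le _ _).trans_eq (by rw [htranspose])
    _ = ‖wᵀ * w‖ + normPerturbation w ε := by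
        rw [normPerturbation, specNorm, ← hM, ← Matrix.cstar_norm_def]; ring

theorem div_le_representability (w ε : Matrix (Fin m) (Fin d) ℝ) (i : Fin d) {p q : ℝ}
    (hq : 0 < q) (hp : p ≤ (wᵀ * w) i i) (hwq : ‖wᵀ * w‖ ≤ q) :
    (p + diagPerturbation w ε i) / (q + normPerturbation w ε) ≤ representability (w + ε) i := by
  have hnorm : 0 ≤ normPerturbation w ε := norm_nonneg _
  have hrep : 0 ≤ representability (w + ε) i := sq_nonneg _
  rw [div_le_iff₀ (by linarith)]
  calc p + diagPerturbation w ε i ≤ ((w + ε)ᵀ * (w + ε)) i i := by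
        rw [gram_add_diag]; linarith
    _ ≤ ‖(w + ε)ᵀ * (w + ε)‖ * representability (w + ε) i :=
        gram_diag_le_norm_mul_representability _ _
    _ ≤ (q + normPerturbation w ε) * representability (w + ε) i := by
        gcongr
        exact (norm_gram_add_le w ε).trans (by linarith)
    _ = representability (w + ε) i * (q + normPerturbation w ε) := mul_comm _ _

end Representability

section LossReduction

variable {m d : ℕ}

/-- The empirical second moment matrix `|ι|⁻¹ ∑ₛ xₛ xₛᵀ` of a finite family of points. -/
def empMoment {ι : Type*} [Fintype ι] (x : ι → EuclideanSpace ℝ (Fin d)) :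
    Matrix (Fin d) (Fin d) ℝ :=
  (1 / (Fintype.card ι : ℝ)) • ∑ s, Matrix.vecMulVec (x s).ofLp (x s).ofLp

theorem empMoment_apply {ι : Type*} [Fintype ι] (x : ι → EuclideanSpace ℝ (Fin d)) (i j : Fin d) :
    empMoment x i j = (1 / (Fintype.card ι : ℝ)) * ∑ s, x s i * x s j := by
  simp [empMoment, Matrix.sum_apply, Matrix.vecMulVec_apply]

theorem transpose_empMoment {ι : Type*} [Fintype ι] (x : ι → EuclideanSpace ℝ (Fin d)) :
    (empMoment x)ᵀ = empMoment x := by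
  ext i j
  simp only [Matrix.transpose_apply, empMoment_apply, mul_comm (x _ j)]

theorem empMoment_sigma {n : ℕ} {N : Fin n → ℕ}
    (x : (k : Fin n) → Fin (N k) → EuclideanSpace ℝ (Fin d)) :
    empMoment (fun p : (k : Fin n) × Fin (N k) => x p.1 p.2)
      = ∑ k, ((N k : ℝ) / ∑ l, (N l : ℝ)) • empMoment (x k) := by
  simp only [empMoment, Fintype.card_sigma, Fintype.card_fin, Nat.cast_sum, Fintype.sum_sigma,
    Finset.smul_sum (s := Finset.univ (α := Fin n)), smul_smul]
  refine Finset.sum_congr rfl fun k _ => ?_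
  rcases Nat.eq_zero_or_pos (N k) with hk | hk
  · have : IsEmpty (Fin (N k)) := by rw [hk]; infer_instance
    simp
  · congr 1
    field_simp

theorem gramLoss_sum_smul {τ κ ι : Type*} [Fintype τ] [Fintype κ] [Fintype ι] {a : τ → ℝ}
    (ha : ∑ k, a k = 1) (X : τ → Matrix ι ι ℝ) (w : Matrix κ ι ℝ) :
    gramLoss (∑ k, a k • X k) w = ∑ k, a k * gramLoss (X k) w := by
  simp only [gramLoss, mul_add, Finset.sum_add_distrib, ← Finset.sum_mul, ha, one_mul,
    Matrix.sum_mul, Matrix.trace_sum, Matrix.smul_mul, Matrix.trace_smul, smul_eq_mul, mul_neg,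
    Finset.sum_neg_distrib]

theorem frobSq_eq_trace (M : Matrix (Fin d) (Fin d) ℝ) : frobSq M = (M * Mᵀ).trace := by
  simp only [frobSq, Matrix.trace, Matrix.diag_apply, Matrix.mul_apply, Matrix.transpose_apply,
    pow_two]

theorem frobSq_gram (w : Matrix (Fin m) (Fin d) ℝ) :
    frobSq (wᵀ * w) = ((wᵀ * w) * (wᵀ * w)).trace := by
  rw [frobSq_eq_trace, Matrix.transpose_mul, Matrix.transpose_transpose]

theorem trace_empMoment_mul_gram {ι : Type*} [Fintype ι] (x : ι → EuclideanSpace ℝ (Fin d))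
    (w : Matrix (Fin m) (Fin d) ℝ) :
    (empMoment x * (wᵀ * w)).trace = (1 / (Fintype.card ι : ℝ)) *
      ∑ s, ⟪Matrix.toEuclideanLin w (x s), Matrix.toEuclideanLin w (x s)⟫_ℝ := by
  have hinner : ∀ s, ⟪Matrix.toEuclideanLin w (x s), Matrix.toEuclideanLin w (x s)⟫_ℝ
      = (wᵀ * w * Matrix.vecMulVec (x s).ofLp (x s).ofLp).trace := fun s => by
    rw [trace_mul_vecMulVec, dotProduct_gram_mulVec]
    rfl
  simp only [hinner, empMoment, Matrix.trace_mul_comm _ (wᵀ * w), Matrix.mul_smul, Matrix.mul_sum,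
    Matrix.trace_smul, Matrix.trace_sum, smul_eq_mul]

theorem IsCenteredNoise.integral_inner_add
    {π : Measure (EuclideanSpace ℝ (Fin m) × EuclideanSpace ℝ (Fin m))} (hπ : IsCenteredNoise π)
    (v : EuclideanSpace ℝ (Fin m)) :
    ∫ p, ⟪v + p.1, v + p.2⟫_ℝ ∂π = ⟪v, v⟫_ℝ + ∫ p, ⟪p.1, p.2⟫_ℝ ∂π := by
  have := hπ.prob
  have hfst := hπ.integrable_fst.const_inner (𝕜 := ℝ) v
  have hsnd := hπ.integrable_snd.const_inner (𝕜 := ℝ) v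
  have hexpand : ∀ p : EuclideanSpace ℝ (Fin m) × EuclideanSpace ℝ (Fin m),
      ⟪v + p.1, v + p.2⟫_ℝ = ⟪v, v⟫_ℝ + ⟪v, p.2⟫_ℝ + ⟪v, p.1⟫_ℝ + ⟪p.1, p.2⟫_ℝ := fun p => by
    rw [inner_add_left, inner_add_right, inner_add_right, real_inner_comm v p.1]
    ring
  simp_rw [hexpand]
  rw [integral_add (((integrable_const _).fun_add hsnd).fun_add hfst) hπ.integrable_inner,
    integral_add ((integrable_const _).fun_add hsnd) hfst, integral_add (integrable_const _) hsnd,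
    integral_inner hπ.integrable_fst, integral_inner hπ.integrable_snd, hπ.mean_fst, hπ.mean_snd]
  simp

theorem localLoss_eq_gramLoss_sub {N : ℕ} (hN : 0 < N)
    {π : Measure (EuclideanSpace ℝ (Fin m) × EuclideanSpace ℝ (Fin m))} (hπ : IsCenteredNoise π)
    (x : Fin N → EuclideanSpace ℝ (Fin d)) (w : Matrix (Fin m) (Fin d) ℝ) :
    localLoss π x w = gramLoss (empMoment x) w - ∫ p, ⟪p.1, p.2⟫_ℝ ∂π := by
  simp only [localLoss, gramLoss, hπ.integral_inner_add, frobSq_gram, trace_empMoment_mul_gram,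
    Finset.sum_add_distrib, Finset.sum_const, Finset.card_univ, Fintype.card_fin, nsmul_eq_mul]
  field_simp
  ring

theorem globalLoss_eq_gramLoss_sub {n : ℕ} [NeZero n] {N : Fin n → ℕ} (hN : ∀ k, 0 < N k)
    {π : Fin n → Measure (EuclideanSpace ℝ (Fin m) × EuclideanSpace ℝ (Fin m))}
    (hπ : ∀ k, IsCenteredNoise (π k))
    (x : (k : Fin n) → Fin (N k) → EuclideanSpace ℝ (Fin d)) (w : Matrix (Fin m) (Fin d) ℝ) :
    globalLoss π x w = gramLoss (empMoment fun p : (k : Fin n) × Fin (N k) => x p.1 p.2) w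
      - ∑ k, ((N k : ℝ) / ∑ l, (N l : ℝ)) * ∫ p, ⟪p.1, p.2⟫_ℝ ∂π k := by
  have hweights : ∑ k, (N k : ℝ) / ∑ l, (N l : ℝ) = 1 := by
    rw [← Finset.sum_div, div_self]
    exact (Finset.sum_pos (fun l _ => Nat.cast_pos.2 (hN l)) Finset.univ_nonempty).ne'
  simp only [globalLoss, empMoment_sigma, gramLoss_sum_smul hweights, ← Finset.sum_sub_distrib,
    ← mul_sub]
  exact Finset.sum_congr rfl fun k _ => by rw [localLoss_eq_gramLoss_sub (hN k) (hπ k)]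

theorem isLocalMin_gramLoss_of_localLoss {N : ℕ} (hN : 0 < N)
    {π : Measure (EuclideanSpace ℝ (Fin m) × EuclideanSpace ℝ (Fin m))} (hπ : IsCenteredNoise π)
    {x : Fin N → EuclideanSpace ℝ (Fin d)} {w : Matrix (Fin m) (Fin d) ℝ}
    (hw : IsLocalMin (localLoss π x) w) : IsLocalMin (gramLoss (empMoment x)) w :=
  hw.mono fun v hv => by
    simpa only [localLoss_eq_gramLoss_sub hN hπ, sub_le_sub_iff_right] using hv

theorem isLocalMin_gramLoss_of_globalLoss {n : ℕ} [NeZero n] {N : Fin n → ℕ} (hN : ∀ k, 0 < N k)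
    {π : Fin n → Measure (EuclideanSpace ℝ (Fin m) × EuclideanSpace ℝ (Fin m))}
    (hπ : ∀ k, IsCenteredNoise (π k))
    {x : (k : Fin n) → Fin (N k) → EuclideanSpace ℝ (Fin d)} {w : Matrix (Fin m) (Fin d) ℝ}
    (hw : IsLocalMin (globalLoss π x) w) :
    IsLocalMin (gramLoss (empMoment fun p : (k : Fin n) × Fin (N k) => x p.1 p.2)) w :=
  hw.mono fun v hv => by
    simpa only [globalLoss_eq_gramLoss_sub hN hπ, sub_le_sub_iff_right] using hv

end LossReduction

section Concentration

variable {ι Ω : Type*} [Fintype ι] [MeasurableSpace Ω] {P : Measure Ω} {d : ℕ}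

theorem memLp_average {Y : ι → Ω → ℝ} (hY : ∀ s, MemLp (Y s) 2 P) :
    MemLp (fun ω => (1 / (Fintype.card ι : ℝ)) * ∑ s, Y s ω) 2 P :=
  (memLp_finsetSum _ fun s _ => hY s).const_mul _

theorem integral_sq_average_sub_le [IsProbabilityMeasure P] {Y : ι → Ω → ℝ}
    (hY : ∀ s, MemLp (Y s) 2 P) (hind : Pairwise fun s t => IndepFun (Y s) (Y t) P) :
    ∫ ω, ((1 / (Fintype.card ι : ℝ)) * ∑ s, Y s ω
        - (1 / (Fintype.card ι : ℝ)) * ∑ s, ∫ ω, Y s ω ∂P) ^ 2 ∂P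
      ≤ (1 / (Fintype.card ι : ℝ)) ^ 2 * ∑ s, ∫ ω, Y s ω ^ 2 ∂P := by
  have hmean : ∫ ω, (1 / (Fintype.card ι : ℝ)) * ∑ s, Y s ω ∂P
      = (1 / (Fintype.card ι : ℝ)) * ∑ s, ∫ ω, Y s ω ∂P := by
    rw [integral_const_mul, integral_finsetSum _ fun s _ => (hY s).integrable one_le_two]
  have hvar : variance (fun ω => ∑ s, Y s ω) P = ∑ s, variance (Y s) P := by
    rw [← IndepFun.variance_sum (fun s _ => hY s) fun s _ t _ hst => hind hst, Finset.sum_fn]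
  rw [← hmean, ← variance_eq_integral (memLp_average hY).aemeasurable, variance_const_mul, hvar]
  gcongr with s
  exact variance_le_expectation_sq (hY s).aestronglyMeasurable

theorem sum_coord_mul_sq (x : EuclideanSpace ℝ (Fin d)) :
    ∑ i, ∑ j, (x i * x j) ^ 2 = ‖x‖ ^ 4 := by
  rw [show ‖x‖ ^ 4 = ‖x‖ ^ 2 * ‖x‖ ^ 2 by ring, EuclideanSpace.real_norm_sq_eq,
    Finset.sum_mul_sum]
  simp_rw [mul_pow]

theorem memLp_coord_mul {x : Ω → EuclideanSpace ℝ (Fin d)} (hx : AEMeasurable x P)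
    (hnorm : Integrable (fun ω => ‖x ω‖ ^ 4) P) (i j : Fin d) :
    MemLp (fun ω => x ω i * x ω j) 2 P := by
  have hmeas : AEMeasurable (fun ω => x ω i * x ω j) P := by fun_prop
  rw [memLp_two_iff_integrable_sq hmeas.aestronglyMeasurable]
  refine hnorm.mono' (by fun_prop) (Filter.Eventually.of_forall fun ω => ?_)
  have hi := PiLp.norm_apply_le (x ω) i
  have hj := PiLp.norm_apply_le (x ω) j
  calc ‖(x ω i * x ω j) ^ 2‖ = (‖x ω i‖ * ‖x ω j‖) ^ 2 := by rw [norm_pow, norm_mul]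
    _ ≤ (‖x ω‖ * ‖x ω‖) ^ 2 := by gcongr
    _ = ‖x ω‖ ^ 4 := by ring

theorem sum_integral_coord_mul_sq {x : Ω → EuclideanSpace ℝ (Fin d)} (hx : AEMeasurable x P)
    (hnorm : Integrable (fun ω => ‖x ω‖ ^ 4) P) :
    ∑ i, ∑ j, ∫ ω, (x ω i * x ω j) ^ 2 ∂P = ∫ ω, ‖x ω‖ ^ 4 ∂P := by
  have hint : ∀ i j, Integrable (fun ω => (x ω i * x ω j) ^ 2) P := fun i j =>
    (memLp_coord_mul hx hnorm i j).integrable_sq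
  simp_rw [← sum_coord_mul_sq]
  rw [integral_finsetSum _ fun i _ => integrable_finsetSum _ fun j _ => hint i j]
  exact Finset.sum_congr rfl fun i _ => (integral_finsetSum _ fun j _ => hint i j).symm

variable {x : ι → Ω → EuclideanSpace ℝ (Fin d)} {M : Matrix (Fin d) (Fin d) ℝ}

theorem integrable_sq_empMoment_sub [IsFiniteMeasure P] (hx : ∀ s, AEMeasurable (x s) P)
    (hnorm : ∀ s, Integrable (fun ω => ‖x s ω‖ ^ 4) P) (i j : Fin d) :
    Integrable (fun ω => (empMoment (fun s => x s ω) - M) i j ^ 2) P := by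
  simp only [Matrix.sub_apply, empMoment_apply]
  exact ((memLp_average fun s => memLp_coord_mul (hx s) (hnorm s) i j).sub
    (memLp_const _)).integrable_sq

theorem integrable_frobSq_empMoment_sub [IsFiniteMeasure P] (hx : ∀ s, AEMeasurable (x s) P)
    (hnorm : ∀ s, Integrable (fun ω => ‖x s ω‖ ^ 4) P) :
    Integrable (fun ω => frobSq (empMoment (fun s => x s ω) - M)) P :=
  integrable_finsetSum _ fun i _ => integrable_finsetSum _ fun j _ =>
    integrable_sq_empMoment_sub hx hnorm i j

theorem integral_frobSq_empMoment_sub_le [IsProbabilityMeasure P] [Nonempty ι]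
    (hx : ∀ s, AEMeasurable (x s) P) (hind : Pairwise fun s t => IndepFun (x s) (x t) P)
    (hM : ∀ i j, M i j = (1 / (Fintype.card ι : ℝ)) * ∑ s, ∫ ω, x s ω i * x s ω j ∂P)
    (hnorm : ∀ s, Integrable (fun ω => ‖x s ω‖ ^ 4) P) {B : ℝ}
    (hB : ∀ s, ∫ ω, ‖x s ω‖ ^ 4 ∂P ≤ B) :
    ∫ ω, frobSq (empMoment (fun s => x s ω) - M) ∂P ≤ B / Fintype.card ι := by
  have hentry : ∀ i j, ∫ ω, (empMoment (fun s => x s ω) - M) i j ^ 2 ∂P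
      ≤ (1 / (Fintype.card ι : ℝ)) ^ 2 * ∑ s, ∫ ω, (x s ω i * x s ω j) ^ 2 ∂P := fun i j => by
    have hcoord : Measurable fun v : EuclideanSpace ℝ (Fin d) => v i * v j := by fun_prop
    simp only [Matrix.sub_apply, empMoment_apply, hM]
    exact integral_sq_average_sub_le (fun s => memLp_coord_mul (hx s) (hnorm s) i j)
      fun s t hst => (hind hst).comp hcoord hcoord
  have hint := fun i j => integrable_sq_empMoment_sub (M := M) hx hnorm i j
  calc ∫ ω, frobSq (empMoment (fun s => x s ω) - M) ∂P
      = ∑ i, ∑ j, ∫ ω, (empMoment (fun s => x s ω) - M) i j ^ 2 ∂P := by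
        simp only [frobSq]
        rw [integral_finsetSum _ fun i _ => integrable_finsetSum _ fun j _ => hint i j]
        exact Finset.sum_congr rfl fun i _ => integral_finsetSum _ fun j _ => hint i j
    _ ≤ ∑ i, ∑ j, (1 / (Fintype.card ι : ℝ)) ^ 2 * ∑ s, ∫ ω, (x s ω i * x s ω j) ^ 2 ∂P := by
        gcongr with i _ j _
        exact hentry i j
    _ = (1 / (Fintype.card ι : ℝ)) ^ 2 * ∑ s, ∫ ω, ‖x s ω‖ ^ 4 ∂P := by
        simp_rw [← fun s => sum_integral_coord_mul_sq (hx s) (hnorm s), ← Finset.mul_sum,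
          Finset.sum_comm (s := Finset.univ (α := ι))]
    _ ≤ (1 / (Fintype.card ι : ℝ)) ^ 2 * ∑ _s : ι, B := by
        gcongr with s
        exact hB s
    _ = B / Fintype.card ι := by
        rw [Finset.sum_const, Finset.card_univ, nsmul_eq_mul]
        field_simp

theorem measure_le_frobSq_empMoment_sub_le [IsProbabilityMeasure P] [Nonempty ι]
    (hx : ∀ s, AEMeasurable (x s) P) (hind : Pairwise fun s t => IndepFun (x s) (x t) P)
    (hM : ∀ i j, M i j = (1 / (Fintype.card ι : ℝ)) * ∑ s, ∫ ω, x s ω i * x s ω j ∂P)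
    (hnorm : ∀ s, Integrable (fun ω => ‖x s ω‖ ^ 4) P) {B : ℝ}
    (hB : ∀ s, ∫ ω, ‖x s ω‖ ^ 4 ∂P ≤ B) {δ : ℝ} (hδ : 0 < δ) :
    P {ω | δ ≤ frobSq (empMoment (fun s => x s ω) - M)}
      ≤ ENNReal.ofReal (B / (Fintype.card ι * δ)) := by
  have hmarkov := mul_meas_ge_le_integral_of_nonneg
    (Filter.Eventually.of_forall fun ω => show 0 ≤ frobSq (empMoment (fun s => x s ω) - M) from
      Finset.sum_nonneg fun i _ => Finset.sum_nonneg fun j _ => sq_nonneg _)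
    (integrable_frobSq_empMoment_sub (M := M) hx hnorm) δ
  rw [← ofReal_measureReal]
  refine ENNReal.ofReal_le_ofReal ?_
  rw [← div_div, le_div_iff₀ hδ, mul_comm]
  exact hmarkov.trans (integral_frobSq_empMoment_sub_le hx hind hM hnorm hB)

end Concentration

section Isotropic

variable {ι κ Ω Ω' : Type*} [MeasurableSpace Ω] [MeasurableSpace Ω'] {P : Measure Ω}
  {P' : Measure Ω'}

/-- A family of square integrable random variables that are centered and orthonormal: the only
features of the randomness of a data point that its second moment matrix depends on. -/
structure IsIsotropic [DecidableEq ι] (z : ι → Ω → ℝ) (P : Measure Ω) : Prop where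
  memLp : ∀ l, MemLp (z l) 2 P
  integral_eq_zero : ∀ l, ∫ ω, z l ω ∂P = 0
  integral_mul : ∀ k l, ∫ ω, z k ω * z l ω ∂P = if k = l then 1 else 0

theorem IsIsotropic.pi [DecidableEq ι] [Fintype ι] {ν : Measure ℝ} [IsProbabilityMeasure ν]
    (hν : MemLp (fun q : ℝ => q) 2 ν) (hmean : ∫ q, q ∂ν = 0) (hvar : ∫ q, q ^ 2 ∂ν = 1) :
    IsIsotropic (fun (l : ι) (q : ι → ℝ) => q l) (Measure.pi fun _ => ν) := by
  have hzero : ∀ l : ι, ∫ q : ι → ℝ, q l ∂(Measure.pi fun _ => ν) = 0 := fun l => by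
    rw [integral_comp_eval (μ := fun _ : ι => ν) (f := fun q : ℝ => q) (by fun_prop), hmean]
  refine ⟨fun l => hν.comp_measurePreserving (measurePreserving_eval (fun _ : ι => ν) l), hzero,
    fun k l => ?_⟩
  split_ifs with hkl
  · subst hkl
    simp_rw [← pow_two]
    rw [integral_comp_eval (μ := fun _ : ι => ν) (f := fun q : ℝ => q ^ 2) (by fun_prop), hvar]
  · have hind : iIndepFun (fun (l : ι) (q : ι → ℝ) => q l) (Measure.pi fun _ : ι => ν) :=
      iIndepFun_pi (X := fun _ q => q) fun _ => by fun_prop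
    rw [(hind.indepFun hkl).integral_fun_mul_eq_mul_integral
      (measurable_pi_apply k).aestronglyMeasurable (measurable_pi_apply l).aestronglyMeasurable,
      hzero, zero_mul]

theorem IsIsotropic.prod [DecidableEq ι] [DecidableEq κ] [IsProbabilityMeasure P]
    [IsProbabilityMeasure P'] {z : ι → Ω → ℝ} {z' : κ → Ω' → ℝ} (hz : IsIsotropic z P)
    (hz' : IsIsotropic z' P') :
    IsIsotropic (fun s (p : Ω × Ω') => Sum.elim (fun l => z l p.1) (fun l => z' l p.2) s)
      (P.prod P') where
  memLp := Sum.rec (fun l => (hz.memLp l).comp_fst P') fun l => (hz'.memLp l).comp_snd P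
  integral_eq_zero := by
    rintro (l | l)
    · simp [integral_fun_fst (z l), hz.integral_eq_zero]
    · simp [integral_fun_snd (z' l), hz'.integral_eq_zero]
  integral_mul := by
    rintro (k | k) (l | l)
    · simp [integral_fun_fst fun ω => z k ω * z l ω, hz.integral_mul]
    · simp [integral_prod_mul (z k) (z' l), hz.integral_eq_zero]
    · simp [mul_comm (z' k _), integral_prod_mul (z l) (z' k), hz.integral_eq_zero]
    · simp [integral_fun_snd fun ω => z' k ω * z' l ω, hz'.integral_mul]

theorem IsIsotropic.integral_affine_mul [DecidableEq ι] [Fintype ι] [IsProbabilityMeasure P]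
    {z : ι → Ω → ℝ} (hz : IsIsotropic z P) (a b : ℝ) (u v : ι → ℝ) :
    ∫ ω, (a + ∑ l, u l * z l ω) * (b + ∑ l, v l * z l ω) ∂P = a * b + ∑ l, u l * v l := by
  have hlin : ∀ t : ι → ℝ, MemLp (fun ω => ∑ l, t l * z l ω) 2 P := fun t =>
    memLp_finsetSum _ fun l _ => (hz.memLp l).const_mul _
  have hmean : ∀ t : ι → ℝ, ∫ ω, ∑ l, t l * z l ω ∂P = 0 := fun t => by
    rw [integral_finsetSum _ fun l _ => ((hz.memLp l).integrable one_le_two).const_mul _]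
    simp [integral_const_mul, hz.integral_eq_zero]
  have hquad : ∫ ω, (∑ l, u l * z l ω) * ∑ l, v l * z l ω ∂P = ∑ l, u l * v l := by
    have hterm : ∀ k l, Integrable (fun ω => u k * v l * (z k ω * z l ω)) P := fun k l =>
      ((hz.memLp k).integrable_mul (hz.memLp l)).const_mul _
    simp_rw [Finset.sum_mul_sum, fun k l ω => mul_mul_mul_comm (u k) (z k ω) (v l) (z l ω)]
    rw [integral_finsetSum _ fun k _ => integrable_finsetSum _ fun l _ => hterm k l]
    simp_rw [integral_finsetSum _ fun l _ => hterm _ l, integral_const_mul, hz.integral_mul]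
    simp
  have hu := (hlin u).integrable one_le_two
  have hv := (hlin v).integrable one_le_two
  have huv : Integrable (fun ω => (∑ l, u l * z l ω) * ∑ l, v l * z l ω) P :=
    (hlin u).integrable_mul (hlin v)
  have hexpand : ∀ ω, (a + ∑ l, u l * z l ω) * (b + ∑ l, v l * z l ω)
      = a * b + a * (∑ l, v l * z l ω) + b * (∑ l, u l * z l ω)
        + (∑ l, u l * z l ω) * ∑ l, v l * z l ω := fun ω => by ring
  simp_rw [hexpand]
  rw [integral_add (((integrable_const _).fun_add (hv.const_mul a)).fun_add (hu.const_mul b)) huv,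
    integral_add ((integrable_const _).fun_add (hv.const_mul a)) (hu.const_mul b),
    integral_add (integrable_const _) (hv.const_mul a), hquad]
  simp only [integral_const_mul, hmean, integral_const, probReal_univ, one_smul, mul_zero, add_zero]

end Isotropic

section DataLaw

instance : IsProbabilityMeasure signLaw where
  measure_univ := by
    simp only [signLaw, Measure.coe_add, Measure.coe_smul, Pi.add_apply, Pi.smul_apply,
      measure_univ, smul_eq_mul, mul_one]
    rw [← ENNReal.ofReal_add (by norm_num) (by norm_num)]
    norm_num

theorem ae_abs_eq_one_signLaw : ∀ᵐ q ∂signLaw, |q| = 1 := by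
  simp [signLaw, ae_add_measure_iff]

theorem integrable_signLaw (f : ℝ → ℝ) : Integrable f signLaw :=
  ((integrable_dirac (by simp)).smul_measure ENNReal.ofReal_ne_top).add_measure
    ((integrable_dirac (by simp)).smul_measure ENNReal.ofReal_ne_top)

theorem integral_signLaw (f : ℝ → ℝ) : ∫ q, f q ∂signLaw = (f 1 + f (-1)) / 2 := by
  unfold signLaw
  rw [integral_add_measure ((integrable_dirac (by simp)).smul_measure ENNReal.ofReal_ne_top)
    ((integrable_dirac (by simp)).smul_measure ENNReal.ofReal_ne_top), integral_smul_measure,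
    integral_smul_measure, integral_dirac, integral_dirac]
  simp only [one_div, inv_nonneg, Nat.ofNat_nonneg, ENNReal.toReal_ofReal, smul_eq_mul]
  ring

theorem integral_sq_gaussianReal : ∫ q, q ^ 2 ∂gaussianReal 0 1 = 1 := by
  have hvar := variance_id_gaussianReal (μ := 0) (v := 1)
  rw [variance_of_integral_eq_zero aemeasurable_id (by simp)] at hvar
  simpa using hvar

theorem isIsotropic_nuisance {n d : ℕ} :
    IsIsotropic (fun s (p : (Fin n → ℝ) × (Fin d → ℝ)) => Sum.elim p.1 p.2 s)
      ((Measure.pi fun _ : Fin n => signLaw).prod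
        (Measure.pi fun _ : Fin d => gaussianReal 0 1)) := by
  refine .prod (.pi ?_ ?_ ?_) (.pi ?_ ?_ integral_sq_gaussianReal)
  · exact (memLp_two_iff_integrable_sq (by fun_prop)).2 (integrable_signLaw _)
  · simp [integral_signLaw]
  · simp [integral_signLaw]
  · exact memLp_id_gaussianReal' 2 (by norm_num)
  · simp

variable {n d : ℕ} (h : n ≤ d) (c : Fin (2 * n))

theorem measurable_classPoint : Measurable (classPoint h c) := by
  unfold classPoint
  fun_prop

instance : IsProbabilityMeasure (classLaw h c) :=
  Measure.isProbabilityMeasure_map (measurable_classPoint h c).aemeasurable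

theorem basisVec_apply_mul_apply (l : Fin n) (i j : Fin d) :
    basisVec h l i * basisVec h l j = if i = j then basisVec h l i else 0 := by
  by_cases hij : i = j <;> by_cases hil : i = Fin.castLE h l <;> simp_all [basisVec]

theorem classSign_mul_self : classSign c * classSign c = 1 := by
  rw [classSign, ← pow_add, ← two_mul, pow_mul, neg_one_sq, one_pow]

/-- The coordinates of a data point are affine in the family of `isIsotropic_nuisance`; these are
the coefficients of its `i`-th coordinate. -/
def classCoeff (i : Fin d) : Fin n ⊕ Fin d → ℝ :=
  Sum.elim (fun l => if l = classDir c then 0 else -((d : ℝ) ^ (1 / 5 : ℝ) * basisVec h l i))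
    fun l => if i = l then (d : ℝ) ^ (-(1 / 5) : ℝ) else 0

theorem classPoint_apply (p : (Fin n → ℝ) × (Fin d → ℝ)) (i : Fin d) :
    classPoint h c p i = classSign c * basisVec h (classDir c) i
      + ∑ l, classCoeff h c i l * Sum.elim p.1 p.2 l := by
  have hsum : ∑ l, (if l = classDir c then 0 else -((d : ℝ) ^ (1 / 5 : ℝ) * basisVec h l i)) * p.1 l
      = -∑ l ∈ Finset.univ.erase (classDir c), (d : ℝ) ^ (1 / 5 : ℝ) * p.1 l * basisVec h l i := by
    simp only [← Finset.filter_ne', Finset.sum_filter, ← Finset.sum_neg_distrib]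
    refine Finset.sum_congr rfl fun l _ => ?_
    by_cases hl : l = classDir c
    · simp [hl]
    · simp only [hl, if_false, ne_eq, not_false_iff, if_true]
      ring
  simp only [classCoeff, Fintype.sum_sum_type, Sum.elim_inl, Sum.elim_inr, hsum]
  simp [classPoint]
  ring

/-- The diagonal of the second moment matrix of a data point of class `c`. -/
def classDiag (i : Fin d) : ℝ :=
  (d : ℝ) ^ (-(2 / 5) : ℝ)
    + ∑ l, (if l = classDir c then 1 else (d : ℝ) ^ (2 / 5 : ℝ)) * basisVec h l i

theorem classDiag_eq_add_sum (i : Fin d) :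
    classDiag h c i = (d : ℝ) ^ (-(2 / 5) : ℝ) + (basisVec h (classDir c) i
      + ∑ l, if l = classDir c then 0 else (d : ℝ) ^ (2 / 5 : ℝ) * basisVec h l i) := by
  have hsplit : ∀ l, (if l = classDir c then 1 else (d : ℝ) ^ (2 / 5 : ℝ)) * basisVec h l i
      = (if l = classDir c then basisVec h l i else 0)
        + if l = classDir c then 0 else (d : ℝ) ^ (2 / 5 : ℝ) * basisVec h l i := fun l => by
    split_ifs <;> ring
  simp only [classDiag, hsplit, Finset.sum_add_distrib, Finset.sum_ite_eq', Finset.mem_univ,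
    if_true]

theorem integral_coord_mul_classLaw (i j : Fin d) :
    ∫ x, x i * x j ∂classLaw h c = Matrix.diagonal (classDiag h c) i j := by
  have hsq : ∀ r : ℝ, (d : ℝ) ^ r * (d : ℝ) ^ r = (d : ℝ) ^ (r * 2) := fun r => by
    rw [← pow_two, ← Real.rpow_mul_natCast (Nat.cast_nonneg d), Nat.cast_ofNat]
  have hsignal : classSign c * basisVec h (classDir c) i * (classSign c * basisVec h (classDir c) j)
      = if i = j then basisVec h (classDir c) i else 0 := by
    rw [mul_mul_mul_comm, classSign_mul_self, one_mul, basisVec_apply_mul_apply]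
  have hsigns : ∀ l, classCoeff h c i (.inl l) * classCoeff h c j (.inl l)
      = if i = j then if l = classDir c then 0 else (d : ℝ) ^ (2 / 5 : ℝ) * basisVec h l i
        else 0 := fun l => by
    by_cases hl : l = classDir c
    · simp [classCoeff, hl]
    · simp only [classCoeff, Sum.elim_inl, hl, if_false, neg_mul_neg,
        mul_mul_mul_comm _ (basisVec h l i), basisVec_apply_mul_apply, hsq, mul_ite, mul_zero]
      norm_num
  have hnoise : ∑ l, classCoeff h c i (.inr l) * classCoeff h c j (.inr l)
      = if i = j then (d : ℝ) ^ (-(2 / 5) : ℝ) else 0 := by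
    simp only [classCoeff, Sum.elim_inr, mul_ite, ite_mul, zero_mul, mul_zero, hsq,
      Finset.sum_ite_eq, Finset.mem_univ, if_true]
    norm_num
  rw [classLaw, integral_map (measurable_classPoint h c).aemeasurable (by fun_prop)]
  simp_rw [classPoint_apply]
  rw [isIsotropic_nuisance.integral_affine_mul, Matrix.diagonal_apply, Fintype.sum_sum_type,
    hsignal, hnoise]
  simp only [hsigns, classDiag_eq_add_sum]
  split_ifs
  · ring
  · simp

/-- The fourth moment of a standard Gaussian variable; only its finiteness matters. -/
def gaussianFourthMoment : ℝ := ∫ q, q ^ 4 ∂gaussianReal 0 1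

theorem gaussianFourthMoment_nonneg : 0 ≤ gaussianFourthMoment :=
  integral_nonneg fun q => by positivity

theorem integrable_pow_four_gaussianReal : Integrable (fun q : ℝ => q ^ 4) (gaussianReal 0 1) := by
  have hnorm := (memLp_id_gaussianReal' (μ := 0) (v := 1) 4 (by norm_num)).integrable_norm_pow
    (by norm_num)
  simpa only [id, Real.norm_eq_abs, (by decide : Even 4).pow_abs, ENNReal.toReal_ofNat] using hnorm

theorem norm_pow_four_le (ξ : Fin d → ℝ) :
    ‖(WithLp.toLp 2 ξ : EuclideanSpace ℝ (Fin d))‖ ^ 4 ≤ d * ∑ i, ξ i ^ 4 := by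
  have hcauchy := sq_sum_le_card_mul_sum_sq (s := Finset.univ) (f := fun i : Fin d => ξ i ^ 2)
  rw [show 4 = 2 * 2 from rfl, pow_mul, EuclideanSpace.real_norm_sq_eq]
  simpa only [← pow_mul, Finset.card_univ, Fintype.card_fin] using hcauchy

theorem norm_basisVec (l : Fin n) : ‖basisVec h l‖ = 1 := by
  simp [basisVec]

theorem norm_sum_erase_basisVec_le {q : Fin n → ℝ} (hq : ∀ j, |q j| = 1) {t : ℝ} (ht : 0 ≤ t) :
    ‖∑ j ∈ Finset.univ.erase (classDir c), (t * q j) • basisVec h j‖ ≤ (n - 1) * t := by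
  have hn : 1 ≤ n := (Nat.zero_le _).trans_lt (classDir c).2
  refine (norm_sum_le _ _).trans_eq ?_
  simp only [norm_smul, norm_basisVec, Real.norm_eq_abs, abs_mul, hq, abs_of_nonneg ht, mul_one,
    Finset.sum_const, Finset.card_erase_of_mem (Finset.mem_univ _), Finset.card_univ,
    Fintype.card_fin, nsmul_eq_mul, Nat.cast_sub hn, Nat.cast_one]

theorem norm_classPoint_le (hd : 0 < d) (p : (Fin n → ℝ) × (Fin d → ℝ)) (hp : ∀ j, |p.1 j| = 1) :
    ‖classPoint h c p‖ ≤ n * (d : ℝ) ^ (1 / 5 : ℝ)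
      + (d : ℝ) ^ (-(1 / 5) : ℝ) * ‖(WithLp.toLp 2 p.2 : EuclideanSpace ℝ (Fin d))‖ := by
  have hτ : (1 : ℝ) ≤ (d : ℝ) ^ (1 / 5 : ℝ) :=
    Real.one_le_rpow (by exact_mod_cast hd) (by norm_num)
  have hfeature : ‖classSign c • basisVec h (classDir c)‖ = 1 := by
    simp [norm_smul, norm_basisVec, classSign]
  have hsigns := norm_sum_erase_basisVec_le h c hp (zero_le_one.trans hτ)
  refine (norm_add_le _ _).trans (add_le_add ((norm_sub_le _ _).trans ?_) ?_)
  · linarith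
  · rw [norm_smul, Real.norm_of_nonneg (by positivity)]

theorem norm_pow_four_classPoint_le (hd : 0 < d) (p : (Fin n → ℝ) × (Fin d → ℝ))
    (hp : ∀ j, |p.1 j| = 1) :
    ‖classPoint h c p‖ ^ 4 ≤ 8 * ((n * (d : ℝ) ^ (1 / 5 : ℝ)) ^ 4
      + ((d : ℝ) ^ (-(1 / 5) : ℝ)) ^ 4 * (d * ∑ i, p.2 i ^ 4)) :=
  calc ‖classPoint h c p‖ ^ 4
      ≤ (n * (d : ℝ) ^ (1 / 5 : ℝ)
        + (d : ℝ) ^ (-(1 / 5) : ℝ) * ‖(WithLp.toLp 2 p.2 : EuclideanSpace ℝ (Fin d))‖) ^ 4 := by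
        gcongr
        exact norm_classPoint_le h c hd p hp
    _ ≤ 2 ^ (4 - 1) * ((n * (d : ℝ) ^ (1 / 5 : ℝ)) ^ 4
        + ((d : ℝ) ^ (-(1 / 5) : ℝ) * ‖(WithLp.toLp 2 p.2 : EuclideanSpace ℝ (Fin d))‖) ^ 4) :=
        add_pow_le (by positivity) (by positivity) 4
    _ ≤ 8 * ((n * (d : ℝ) ^ (1 / 5 : ℝ)) ^ 4
        + ((d : ℝ) ^ (-(1 / 5) : ℝ)) ^ 4 * (d * ∑ i, p.2 i ^ 4)) := by
        rw [mul_pow ((d : ℝ) ^ (-(1 / 5) : ℝ))]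
        norm_num only
        gcongr
        exact norm_pow_four_le p.2

theorem integrable_sum_pow_four :
    Integrable (fun ξ : Fin d → ℝ => ∑ i, ξ i ^ 4) (Measure.pi fun _ => gaussianReal 0 1) :=
  integrable_finsetSum _ fun i _ => integrable_comp_eval (μ := fun _ : Fin d => gaussianReal 0 1)
    (i := i) (f := fun q : ℝ => q ^ 4) integrable_pow_four_gaussianReal

theorem integral_sum_pow_four :
    ∫ ξ : Fin d → ℝ, ∑ i, ξ i ^ 4 ∂(Measure.pi fun _ => gaussianReal 0 1)
      = d * gaussianFourthMoment := by
  have heval : ∀ i : Fin d, ∫ ξ : Fin d → ℝ, ξ i ^ 4 ∂(Measure.pi fun _ => gaussianReal 0 1)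
      = gaussianFourthMoment := fun i =>
    integral_comp_eval (μ := fun _ : Fin d => gaussianReal 0 1) (f := fun q : ℝ => q ^ 4)
      (by fun_prop)
  rw [integral_finsetSum _ fun i _ => integrable_comp_eval
    (μ := fun _ : Fin d => gaussianReal 0 1) (i := i) (f := fun q : ℝ => q ^ 4)
    integrable_pow_four_gaussianReal]
  simp [heval]

theorem fourthMoment_classLaw_le (hd : 0 < d) :
    Integrable (fun x => ‖x‖ ^ 4) (classLaw h c) ∧
    ∫ x, ‖x‖ ^ 4 ∂classLaw h c ≤ 8 * ((n * (d : ℝ) ^ (1 / 5 : ℝ)) ^ 4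
      + ((d : ℝ) ^ (-(1 / 5) : ℝ)) ^ 4 * (d * (d * gaussianFourthMoment))) := by
  unfold classLaw
  rw [integrable_map_measure (by fun_prop) (measurable_classPoint h c).aemeasurable,
    integral_map (measurable_classPoint h c).aemeasurable (by fun_prop)]
  set Q := Measure.pi fun _ : Fin n => signLaw
  set Γ := Measure.pi fun _ : Fin d => gaussianReal 0 1
  have hsigns : ∀ᵐ p ∂(Q.prod Γ), ∀ j, |p.1 j| = 1 :=
    Measure.quasiMeasurePreserving_fst.ae <| ae_all_iff.2 fun j =>
      (Measure.tendsto_eval_ae_ae (μ := fun _ : Fin n => signLaw) (i := j)).eventually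
        ae_abs_eq_one_signLaw
  have hle : ∀ᵐ p ∂(Q.prod Γ), ‖classPoint h c p‖ ^ 4 ≤ 8 * ((n * (d : ℝ) ^ (1 / 5 : ℝ)) ^ 4
      + ((d : ℝ) ^ (-(1 / 5) : ℝ)) ^ 4 * (d * ∑ i, p.2 i ^ 4)) :=
    hsigns.mono fun p => norm_pow_four_classPoint_le h c hd p
  have hnoise : Integrable (fun p : (Fin n → ℝ) × (Fin d → ℝ) =>
      ((d : ℝ) ^ (-(1 / 5) : ℝ)) ^ 4 * (d * ∑ i, p.2 i ^ 4)) (Q.prod Γ) :=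
    ((integrable_sum_pow_four.comp_snd Q).const_mul _).const_mul _
  have hbound := ((integrable_const ((n * (d : ℝ) ^ (1 / 5 : ℝ)) ^ 4)).fun_add hnoise).const_mul 8
  have hint : Integrable (fun p => ‖classPoint h c p‖ ^ 4) (Q.prod Γ) :=
    hbound.mono' ((measurable_classPoint h c).norm.pow_const 4).aestronglyMeasurable <|
      hle.mono fun p hp => by rwa [Real.norm_of_nonneg (by positivity)]
  refine ⟨hint, (integral_mono_ae hint hbound hle).trans_eq ?_⟩
  rw [integral_const_mul, integral_add (integrable_const _) hnoise, integral_const_mul,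
    integral_const_mul, integral_fun_snd (fun ξ : Fin d → ℝ => ∑ i, ξ i ^ 4),
    integral_sum_pow_four]
  simp

theorem integral_norm_pow_four_classLaw_le (hd : 0 < d) {c₂ : ℝ}
    (hn : (n : ℝ) ≤ c₂ * (d : ℝ) ^ (1 / 20 : ℝ)) :
    ∫ x, ‖x‖ ^ 4 ∂classLaw h c ≤ 8 * (c₂ ^ 4 + gaussianFourthMoment) * (d : ℝ) ^ (6 / 5 : ℝ) := by
  have hd0 : (0 : ℝ) < d := by exact_mod_cast hd
  have hd1 : (1 : ℝ) ≤ d := by exact_mod_cast hd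
  have hsignal : (n * (d : ℝ) ^ (1 / 5 : ℝ)) ^ 4 ≤ c₂ ^ 4 * (d : ℝ) ^ (6 / 5 : ℝ) :=
    calc (n * (d : ℝ) ^ (1 / 5 : ℝ)) ^ 4
        ≤ (c₂ * (d : ℝ) ^ (1 / 20 : ℝ) * (d : ℝ) ^ (1 / 5 : ℝ)) ^ 4 := by gcongr
      _ = c₂ ^ 4 * (d : ℝ) ^ (1 : ℝ) := by
        rw [mul_assoc, ← Real.rpow_add hd0, mul_pow, ← Real.rpow_mul_natCast hd0.le]
        norm_num
      _ ≤ c₂ ^ 4 * (d : ℝ) ^ (6 / 5 : ℝ) := by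
        gcongr
        norm_num
  have hnoise : (d : ℝ) ^ (6 / 5 : ℝ) = ((d : ℝ) ^ (-(1 / 5) : ℝ)) ^ 4 * (d * d) := by
    rw [← pow_two (d : ℝ), ← Real.rpow_natCast (d : ℝ) 2, ← Real.rpow_mul_natCast hd0.le,
      ← Real.rpow_add hd0]
    norm_num
  refine (fourthMoment_classLaw_le h c hd).2.trans ?_
  linear_combination 8 * hsignal - 8 * gaussianFourthMoment * hnoise

end DataLaw

section TypicalSamples

open scoped Matrix.Norms.L2Operator

variable {ι : Type*} [Fintype ι] {n d : ℕ}

/-- The fraction of the labels `y` that belong to the two classes of direction `j`. -/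
def dirFrac (y : ι → Fin (2 * n)) (j : Fin n) : ℝ :=
  (1 / (Fintype.card ι : ℝ)) * ∑ s, if j = classDir (y s) then 1 else 0

/-- The diagonal of the expected empirical second moment matrix of samples with labels `y`. -/
def avgDiag (h : n ≤ d) (y : ι → Fin (2 * n)) (i : Fin d) : ℝ :=
  (1 / (Fintype.card ι : ℝ)) * ∑ s, classDiag h (y s) i

/-- Samples `x` with labels `y` are typical if their empirical second moment matrix is within
`μ² = d^{-2/5}` of its expectation, the accuracy of the bounds for the local models. -/
def IsTypical (h : n ≤ d) (y : ι → Fin (2 * n)) (x : ι → EuclideanSpace ℝ (Fin d)) : Prop :=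
  ‖empMoment x - Matrix.diagonal (avgDiag h y)‖ ≤ (d : ℝ) ^ (-(2 / 5) : ℝ)

theorem dirFrac_nonneg (y : ι → Fin (2 * n)) (j : Fin n) : 0 ≤ dirFrac y j := by
  unfold dirFrac
  positivity

theorem classDiag_castLE (h : n ≤ d) (c : Fin (2 * n)) (j : Fin n) :
    classDiag h c (Fin.castLE h j)
      = (d : ℝ) ^ (-(2 / 5) : ℝ) + if j = classDir c then 1 else (d : ℝ) ^ (2 / 5 : ℝ) := by
  simp [classDiag, basisVec]

theorem classDiag_of_le (h : n ≤ d) (c : Fin (2 * n)) {i : Fin d} (hi : n ≤ i.val) :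
    classDiag h c i = (d : ℝ) ^ (-(2 / 5) : ℝ) := by
  have hne : ∀ l : Fin n, i ≠ Fin.castLE h l := fun l hl =>
    (l.2.trans_le hi).ne (congrArg Fin.val hl).symm
  simp [classDiag, basisVec, hne]

theorem diagonal_avgDiag_apply {Ω : Type*} [MeasurableSpace Ω] {P : Measure Ω} {h : n ≤ d}
    {y : ι → Fin (2 * n)} {x : ι → Ω → EuclideanSpace ℝ (Fin d)}
    (hx : ∀ s, HasLaw (x s) (classLaw h (y s)) P) (i j : Fin d) :
    Matrix.diagonal (avgDiag h y) i j
      = (1 / (Fintype.card ι : ℝ)) * ∑ s, ∫ ω, x s ω i * x s ω j ∂P := by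
  have hlaw : ∀ s, ∫ ω, x s ω i * x s ω j ∂P
      = Matrix.diagonal (classDiag h (y s)) i j := fun s => by
    rw [← integral_coord_mul_classLaw]
    exact (hx s).integral_comp (f := fun v => v i * v j) (by fun_prop)
  simp_rw [hlaw, Matrix.diagonal_apply]
  split_ifs <;> simp [avgDiag]

variable [Nonempty ι] (h : n ≤ d) (y : ι → Fin (2 * n))

theorem avgDiag_castLE (j : Fin n) :
    avgDiag h y (Fin.castLE h j) = (d : ℝ) ^ (-(2 / 5) : ℝ) + (d : ℝ) ^ (2 / 5 : ℝ)
      - dirFrac y j * ((d : ℝ) ^ (2 / 5 : ℝ) - 1) := by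
  have hterm : ∀ s, (if j = classDir (y s) then 1 else (d : ℝ) ^ (2 / 5 : ℝ))
      = (d : ℝ) ^ (2 / 5 : ℝ)
        - (if j = classDir (y s) then 1 else 0) * ((d : ℝ) ^ (2 / 5 : ℝ) - 1) := fun s => by
    split_ifs <;> ring
  simp only [avgDiag, dirFrac, classDiag_castLE, hterm, Finset.sum_add_distrib,
    Finset.sum_sub_distrib, ← Finset.sum_mul, Finset.sum_const, Finset.card_univ, nsmul_eq_mul]
  field_simp
  ring

theorem avgDiag_of_le {i : Fin d} (hi : n ≤ i.val) :
    avgDiag h y i = (d : ℝ) ^ (-(2 / 5) : ℝ) := by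
  simp [avgDiag, classDiag_of_le h _ hi]

theorem le_avgDiag (i : Fin d) : (d : ℝ) ^ (-(2 / 5) : ℝ) ≤ avgDiag h y i := by
  have hclass : ∀ c, (d : ℝ) ^ (-(2 / 5) : ℝ) ≤ classDiag h c i := fun c =>
    le_add_of_nonneg_right <| Finset.sum_nonneg fun l _ =>
      mul_nonneg (by split_ifs <;> positivity) (by simp [basisVec, apply_ite])
  rw [avgDiag, one_div_mul_eq_div, le_div_iff₀ (Nat.cast_pos.2 Fintype.card_pos), mul_comm,
    ← nsmul_eq_mul, ← Finset.card_univ]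
  exact Finset.card_nsmul_le_sum _ _ _ fun s _ => hclass (y s)

theorem avgDiag_castLE_le (hd : 0 < d) {j : Fin n} {f : ℝ} (hf : f ≤ dirFrac y j) :
    avgDiag h y (Fin.castLE h j) ≤ (d : ℝ) ^ (-(2 / 5) : ℝ) + (d : ℝ) ^ (2 / 5 : ℝ)
      - f * ((d : ℝ) ^ (2 / 5 : ℝ) - 1) := by
  have hτ : 1 ≤ (d : ℝ) ^ (2 / 5 : ℝ) := Real.one_le_rpow (by exact_mod_cast hd) (by norm_num)
  rw [avgDiag_castLE]
  gcongr

theorem le_avgDiag_castLE {j : Fin n} {g : ℝ} (hg : dirFrac y j ≤ g) :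
    (d : ℝ) ^ (-(2 / 5) : ℝ) + (d : ℝ) ^ (2 / 5 : ℝ) - g * (d : ℝ) ^ (2 / 5 : ℝ)
      ≤ avgDiag h y (Fin.castLE h j) := by
  have hτ : 0 ≤ (d : ℝ) ^ (2 / 5 : ℝ) := by positivity
  rw [avgDiag_castLE]
  linarith [dirFrac_nonneg y j, mul_le_mul_of_nonneg_right hg hτ]

theorem norm_avgDiag_le [NeZero n] (hd : 0 < d) {f : ℝ} (hf : ∀ j, f ≤ dirFrac y j) :
    ‖avgDiag h y‖ ≤ (d : ℝ) ^ (-(2 / 5) : ℝ) + (d : ℝ) ^ (2 / 5 : ℝ)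
      - f * ((d : ℝ) ^ (2 / 5 : ℝ) - 1) := by
  have hfeature := fun j => avgDiag_castLE_le h y hd (hf j)
  have hbase := (le_avgDiag h y (Fin.castLE h 0)).trans (hfeature 0)
  have hμ : 0 ≤ (d : ℝ) ^ (-(2 / 5) : ℝ) := by positivity
  refine (pi_norm_le_iff_of_nonneg (hμ.trans hbase)).2 fun i => ?_
  rw [Real.norm_of_nonneg (hμ.trans (le_avgDiag h y i))]
  by_cases hi : i.val < n
  · exact hfeature ⟨i, hi⟩
  · exact (avgDiag_of_le h y (not_lt.1 hi)).trans_le hbase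

variable {h y}

theorem measure_not_isTypical_le {Ω : Type*} [MeasurableSpace Ω] {P : Measure Ω}
    [IsProbabilityMeasure P] {x : ι → Ω → EuclideanSpace ℝ (Fin d)} (hd : 0 < d)
    (hx : ∀ s, HasLaw (x s) (classLaw h (y s)) P)
    (hind : Pairwise fun s t => IndepFun (x s) (x t) P) {c₂ γ : ℝ}
    (hn : (n : ℝ) ≤ c₂ * (d : ℝ) ^ (1 / 20 : ℝ)) (hcard : (d : ℝ) ^ (2 + γ) ≤ Fintype.card ι) :
    P {ω | ¬ IsTypical h y fun s => x s ω}
      ≤ ENNReal.ofReal (8 * (c₂ ^ 4 + gaussianFourthMoment) * (d : ℝ) ^ (-γ)) := by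
  have hd0 : (0 : ℝ) < d := by exact_mod_cast hd
  have hK : 0 ≤ 8 * (c₂ ^ 4 + gaussianFourthMoment) := by
    have := gaussianFourthMoment_nonneg
    positivity
  have hnorm : ∀ s, Integrable (fun ω => ‖x s ω‖ ^ 4) P := fun s => by
    have hint := (fourthMoment_classLaw_le h (y s) hd).1
    rw [← (hx s).map_eq] at hint
    exact hint.comp_aemeasurable (hx s).aemeasurable
  have hmoment : ∀ s, ∫ ω, ‖x s ω‖ ^ 4 ∂P
      ≤ 8 * (c₂ ^ 4 + gaussianFourthMoment) * (d : ℝ) ^ (6 / 5 : ℝ) := fun s =>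
    ((hx s).integral_comp (f := fun v => ‖v‖ ^ 4) (by fun_prop)).trans_le
      (integral_norm_pow_four_classLaw_le h (y s) hd hn)
  have hrate : (d : ℝ) ^ (6 / 5 : ℝ)
      = (d : ℝ) ^ (-γ) * ((d : ℝ) ^ (2 + γ) * ((d : ℝ) ^ (-(2 / 5) : ℝ)) ^ 2) := by
    rw [← Real.rpow_mul_natCast hd0.le, ← Real.rpow_add hd0, ← Real.rpow_add hd0]
    congr 1
    push_cast
    ring
  calc P {ω | ¬ IsTypical h y fun s => x s ω}
      ≤ P {ω | ((d : ℝ) ^ (-(2 / 5) : ℝ)) ^ 2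
          ≤ frobSq (empMoment (fun s => x s ω) - Matrix.diagonal (avgDiag h y))} :=
        measure_mono fun ω hω => (pow_le_pow_left₀ (by positivity) (not_le.1 hω).le 2).trans
          (sq_norm_le_sum_sq _)
    _ ≤ ENNReal.ofReal (8 * (c₂ ^ 4 + gaussianFourthMoment) * (d : ℝ) ^ (6 / 5 : ℝ)
          / (Fintype.card ι * ((d : ℝ) ^ (-(2 / 5) : ℝ)) ^ 2)) :=
        measure_le_frobSq_empMoment_sub_le (fun s => (hx s).aemeasurable) hind
          (diagonal_avgDiag_apply hx) hnorm hmoment (by positivity)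
    _ ≤ ENNReal.ofReal (8 * (c₂ ^ 4 + gaussianFourthMoment) * (d : ℝ) ^ (-γ)) := by
        refine ENNReal.ofReal_le_ofReal ?_
        rw [div_le_iff₀ (by positivity), mul_assoc (8 * _) ((d : ℝ) ^ (-γ)), hrate]
        gcongr

variable {m : ℕ} {x : ι → EuclideanSpace ℝ (Fin d)} {w : Matrix (Fin m) (Fin d) ℝ}

theorem IsTypical.norm_gram_le [NeZero n] (hx : IsTypical h y x) (hd : 0 < d) {f : ℝ}
    (hf : ∀ j, f ≤ dirFrac y j) (hw : IsLocalMin (gramLoss (empMoment x)) w) :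
    ‖wᵀ * w‖ ≤ (d : ℝ) ^ (2 / 5 : ℝ) - f * ((d : ℝ) ^ (2 / 5 : ℝ) - 1)
      + 2 * (d : ℝ) ^ (-(2 / 5) : ℝ) := by
  have hgram := norm_gram_le_norm_add_norm_sub (transpose_empMoment x) hw (avgDiag h y)
  have hdiag := norm_avgDiag_le h y hd hf
  unfold IsTypical at hx
  linarith

theorem IsTypical.le_gram_diag (hx : IsTypical h y x) (hnm : n ≤ m) {j : Fin n} {g : ℝ}
    (hg : dirFrac y j ≤ g) (hw : IsLocalMin (gramLoss (empMoment x)) w) :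
    (d : ℝ) ^ (2 / 5 : ℝ) - g * (d : ℝ) ^ (2 / 5 : ℝ) - 2 * (d : ℝ) ^ (-(2 / 5) : ℝ)
      ≤ (wᵀ * w) (Fin.castLE h j) (Fin.castLE h j) := by
  have hcard : (Finset.univ.filter fun i : Fin d => i.val < n).card ≤ Fintype.card (Fin m) := by
    rw [Fin.card_filter_val_lt, Fintype.card_fin]
    exact (min_le_right _ _).trans hnm
  have hgram := le_gram_diag_add_norm_sub hcard (D := avgDiag h y)
    (η := (d : ℝ) ^ (-(2 / 5) : ℝ)) (by positivity)
    (fun i hi => (avgDiag_of_le h y (by simpa using hi)).le) (transpose_empMoment x) hw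
    (Fin.castLE h j)
  have hdiag := le_avgDiag_castLE h y hg
  unfold IsTypical at hx
  linarith

end TypicalSamples

section ClassProportions

theorem sum_dir_le_offClassCount {n N : ℕ} {k j : Fin n} (hjk : j ≠ k) (y : Fin N → Fin (2 * n)) :
    ∑ s, (if j = classDir (y s) then (1 : ℝ) else 0) ≤ offClassCount k y := by
  rw [Finset.sum_boole, offClassCount]
  gcongr with s
  rintro rfl
  exact hjk

theorem sum_dir_self {n N : ℕ} (k : Fin n) (y : Fin N → Fin (2 * n)) :
    ∑ s, (if k = classDir (y s) then (1 : ℝ) else 0) = N - offClassCount k y := by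
  have hsplit := Finset.card_filter_add_card_filter_not (s := Finset.univ)
    fun s => classDir (y s) = k
  simp only [Finset.card_univ, Fintype.card_fin] at hsplit
  simp only [Finset.sum_boole, eq_comm (a := k), offClassCount, eq_sub_iff_add_eq]
  exact_mod_cast hsplit

theorem dirFrac_le_of_offClassCount_le {n N : ℕ} (hN : 0 < N) {k j : Fin n} (hjk : j ≠ k)
    {y : Fin N → Fin (2 * n)} {θ : ℝ} (hθ : (offClassCount k y : ℝ) ≤ θ * N) :
    dirFrac y j ≤ θ := by
  rw [dirFrac, Fintype.card_fin, one_div_mul_eq_div, div_le_iff₀ (Nat.cast_pos.2 hN)]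
  exact (sum_dir_le_offClassCount hjk y).trans hθ

variable {n : ℕ} {N : Fin n → ℕ} {y : (k : Fin n) → Fin (N k) → Fin (2 * n)} {θ : ℝ}

theorem dirFrac_sigma (j : Fin n) :
    dirFrac (fun p : (k : Fin n) × Fin (N k) => y p.1 p.2) j
      = (∑ k, ∑ s, if j = classDir (y k s) then (1 : ℝ) else 0) / ∑ l, (N l : ℝ) := by
  rw [dirFrac, Fintype.sum_sigma, Fintype.card_sigma, Nat.cast_sum, one_div_mul_eq_div]
  simp only [Fintype.card_fin]

theorem dirFrac_sigma_le (hN : ∀ k, 0 < N k) (hθ : 0 ≤ θ)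
    (hoff : ∀ k, (offClassCount k (y k) : ℝ) ≤ θ * N k) (j : Fin n) :
    dirFrac (fun p : (k : Fin n) × Fin (N k) => y p.1 p.2) j
      ≤ (N j : ℝ) / ∑ l, (N l : ℝ) + θ := by
  have hT : 0 < ∑ l, (N l : ℝ) :=
    Finset.sum_pos (fun l _ => Nat.cast_pos.2 (hN l)) ⟨j, Finset.mem_univ _⟩
  have hclient : ∀ k, ∑ s, (if j = classDir (y k s) then (1 : ℝ) else 0)
      ≤ (if j = k then (N k : ℝ) else 0) + θ * N k := fun k => by
    by_cases hkj : j = k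
    · subst hkj
      rw [sum_dir_self, if_pos rfl]
      linarith [(offClassCount j (y j)).cast_nonneg (α := ℝ),
        mul_nonneg hθ (N j).cast_nonneg]
    · rw [if_neg hkj, zero_add]
      exact (sum_dir_le_offClassCount hkj (y k)).trans (hoff k)
  rw [dirFrac_sigma, div_add' _ _ _ hT.ne']
  gcongr
  refine (Finset.sum_le_sum fun k _ => hclient k).trans_eq ?_
  rw [Finset.sum_add_distrib, ← Finset.mul_sum, Finset.sum_ite_eq, if_pos (Finset.mem_univ j)]

theorem le_dirFrac_sigma (j : Fin n) (hoff : (offClassCount j (y j) : ℝ) ≤ θ * N j) :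
    (1 - θ) * ((N j : ℝ) / ∑ l, (N l : ℝ))
      ≤ dirFrac (fun p : (k : Fin n) × Fin (N k) => y p.1 p.2) j := by
  rw [dirFrac_sigma, ← mul_div_assoc]
  gcongr
  calc (1 - θ) * N j ≤ ∑ s, (if j = classDir (y j s) then (1 : ℝ) else 0) := by
        rw [sum_dir_self]
        linarith
    _ ≤ ∑ k, ∑ s, if j = classDir (y k s) then (1 : ℝ) else 0 :=
        Finset.single_le_sum (f := fun k => ∑ s, if j = classDir (y k s) then (1 : ℝ) else 0)
          (fun k _ => Finset.sum_nonneg fun s _ => by split_ifs <;> norm_num) (Finset.mem_univ j)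

end ClassProportions

section RepresentabilityBounds

open scoped Matrix.Norms.L2Operator

theorem IsTypical.div_le_representability {ι : Type*} [Fintype ι] [Nonempty ι] {n m d : ℕ}
    [NeZero n] {h : n ≤ d} {y : ι → Fin (2 * n)} {x : ι → EuclideanSpace ℝ (Fin d)}
    (hx : IsTypical h y x) (hd : 0 < d) (hnm : n ≤ m) {w : Matrix (Fin m) (Fin d) ℝ}
    (hw : IsLocalMin (gramLoss (empMoment x)) w) {i : Fin n} {f g p q : ℝ}
    (hf : ∀ j, f ≤ dirFrac y j) (hg : dirFrac y i ≤ g)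
    (hp : p ≤ (d : ℝ) ^ (2 / 5 : ℝ) - g * (d : ℝ) ^ (2 / 5 : ℝ) - 2 * (d : ℝ) ^ (-(2 / 5) : ℝ))
    (hq : (d : ℝ) ^ (2 / 5 : ℝ) - f * ((d : ℝ) ^ (2 / 5 : ℝ) - 1) + 2 * (d : ℝ) ^ (-(2 / 5) : ℝ)
      ≤ q) (hq0 : 0 < q) (ε : Matrix (Fin m) (Fin d) ℝ) :
    (p + diagPerturbation w ε (Fin.castLE h i)) / (q + normPerturbation w ε)
      ≤ representability (w + ε) (Fin.castLE h i) :=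
  FedSSL.div_le_representability w ε _ hq0 (hp.trans (hx.le_gram_diag hnm hg hw))
    ((hx.norm_gram_le hd hf hw).trans hq)

variable {n m d : ℕ} {A a b c γ C : ℝ}

theorem mul_rpow_neg_mul_rpow (hd : 0 < d) :
    A * (d : ℝ) ^ (-(4 / 5) : ℝ) * (d : ℝ) ^ (2 / 5 : ℝ) = A * (d : ℝ) ^ (-(2 / 5) : ℝ) := by
  rw [mul_assoc, ← Real.rpow_add (by exact_mod_cast hd)]
  norm_num

theorem rpow_neg_mul_rpow (hd : 0 < d) :
    (d : ℝ) ^ (-(1 / 20) : ℝ) * (d : ℝ) ^ (2 / 5 : ℝ) = (d : ℝ) ^ (7 / 20 : ℝ) := by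
  rw [← Real.rpow_add (by exact_mod_cast hd)]
  norm_num

theorem div_mul_rpow_le_div (hn : 0 < n) (hnc : (n : ℝ) ≤ c * (d : ℝ) ^ (1 / 20 : ℝ))
    (hb : 0 ≤ b) : b / c * (d : ℝ) ^ (-(1 / 20) : ℝ) ≤ b / n := by
  rw [Real.rpow_neg (Nat.cast_nonneg d), ← div_eq_mul_inv, div_div]
  gcongr

theorem div_le_div_mul_rpow (hd : 0 < d) (hc : 0 < c)
    (hcn : c * (d : ℝ) ^ (1 / 20 : ℝ) ≤ n) (hb : 0 ≤ b) :
    b / n ≤ b / c * (d : ℝ) ^ (-(1 / 20) : ℝ) := by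
  rw [Real.rpow_neg (Nat.cast_nonneg d), ← div_eq_mul_inv, div_div]
  gcongr

section Proportions

variable {N : Fin n → ℕ} {y : (k : Fin n) → Fin (N k) → Fin (2 * n)} {θ : ℝ} {j : Fin n}

theorem le_dirFrac_sigma_of_le_proportion (hnc : (n : ℝ) ≤ c * (d : ℝ) ^ (1 / 20 : ℝ))
    (hb : 0 ≤ b) (hprop : b / n ≤ (N j : ℝ) / ∑ l, (N l : ℝ)) (hθ : θ ≤ 1 / 2)
    (hoff : (offClassCount j (y j) : ℝ) ≤ θ * N j) :
    b / c / 2 * (d : ℝ) ^ (-(1 / 20) : ℝ)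
      ≤ dirFrac (fun p : (k : Fin n) × Fin (N k) => y p.1 p.2) j := by
  have hscale := div_mul_rpow_le_div j.pos hnc hb
  have hhalf : (1 / 2 : ℝ) * ((N j : ℝ) / ∑ l, (N l : ℝ))
      ≤ (1 - θ) * ((N j : ℝ) / ∑ l, (N l : ℝ)) := by
    gcongr
    linarith
  linarith [le_dirFrac_sigma j hoff]

theorem dirFrac_sigma_le_of_proportion_le (hd : 0 < d) (hc : 0 < c)
    (hcn : c * (d : ℝ) ^ (1 / 20 : ℝ) ≤ n) (hN : ∀ k, 0 < N k)
    (hprop : (N j : ℝ) / ∑ l, (N l : ℝ) ≤ b / n) (hθ : 0 ≤ θ)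
    (hoff : ∀ k, (offClassCount k (y k) : ℝ) ≤ θ * N k) :
    dirFrac (fun p : (k : Fin n) × Fin (N k) => y p.1 p.2) j
      ≤ b / c * (d : ℝ) ^ (-(1 / 20) : ℝ) + θ := by
  have hn : (0 : ℝ) < n := Nat.cast_pos.2 j.pos
  have hb : 0 ≤ b := by
    rw [← div_mul_cancel₀ b hn.ne']
    exact mul_nonneg (le_trans (by positivity) hprop) hn.le
  linarith [dirFrac_sigma_le hN hθ hoff j, div_le_div_mul_rpow hd hc hcn hb]

theorem exists_forall_mul_rpow_neg_le_half (A : ℝ) :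
    ∃ d₀ : ℕ, 0 < d₀ ∧ ∀ d : ℕ, d₀ ≤ d → A * (d : ℝ) ^ (-(4 / 5) : ℝ) ≤ 1 / 2 := by
  have hlim : Filter.Tendsto (fun d : ℕ => A * (d : ℝ) ^ (-(4 / 5) : ℝ)) Filter.atTop
      (nhds (A * 0)) :=
    ((tendsto_rpow_neg_atTop (by norm_num)).comp tendsto_natCast_atTop_atTop).const_mul A
  obtain ⟨d₀, hd₀⟩ := Filter.eventually_atTop.1 (hlim.eventually_le_const (u := 1 / 2) (by simp))
  exact ⟨max d₀ 1, by simp, fun d hd => hd₀ d ((le_max_left _ _).trans hd)⟩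

theorem exists_dirFrac_sigma_bounds {A c₁ c₂ b₁ b₂ : ℝ} (hA : 0 ≤ A) (hc₁ : 0 < c₁)
    (hb₁ : 0 < b₁) :
    ∃ (a b : ℝ) (d₀ : ℕ), 0 < a ∧ a ≤ b ∧ 0 < d₀ ∧ ∀ d n : ℕ, d₀ ≤ d →
      c₁ * (d : ℝ) ^ (1 / 20 : ℝ) ≤ n → (n : ℝ) ≤ c₂ * (d : ℝ) ^ (1 / 20 : ℝ) →
      ∀ (N : Fin n → ℕ) (y : (k : Fin n) → Fin (N k) → Fin (2 * n)), (∀ k, 0 < N k) →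
      (∀ k, b₁ / n ≤ (N k : ℝ) / ∑ l, (N l : ℝ) ∧ (N k : ℝ) / ∑ l, (N l : ℝ) ≤ b₂ / n) →
      (∀ k, (offClassCount k (y k) : ℝ) ≤ A * (d : ℝ) ^ (-(4 / 5) : ℝ) * N k) → ∀ j,
      a * (d : ℝ) ^ (-(1 / 20) : ℝ) ≤ dirFrac (fun p : (k : Fin n) × Fin (N k) => y p.1 p.2) j ∧
      dirFrac (fun p : (k : Fin n) × Fin (N k) => y p.1 p.2) j
        ≤ b * (d : ℝ) ^ (-(1 / 20) : ℝ) + A * (d : ℝ) ^ (-(4 / 5) : ℝ) := by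
  obtain ⟨d₀, hd₀, hθ⟩ := exists_forall_mul_rpow_neg_le_half A
  have : 0 < max c₁ c₂ := lt_max_of_lt_left hc₁
  refine ⟨b₁ / max c₁ c₂ / 2, max (b₁ / max c₁ c₂ / 2) (b₂ / c₁), d₀, by positivity,
    le_max_left _ _, hd₀, ?_⟩
  intro d n hd hcn hnc N y hN hprop hoff j
  have hnc' : (n : ℝ) ≤ max c₁ c₂ * (d : ℝ) ^ (1 / 20 : ℝ) :=
    hnc.trans (by gcongr; exact le_max_right c₁ c₂)
  refine ⟨le_dirFrac_sigma_of_le_proportion hnc' hb₁.le (hprop j).1 (hθ d hd) (hoff j),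
    (dirFrac_sigma_le_of_proportion_le (hd₀.trans_le hd) hc₁ hcn hN (hprop j).2
      (by positivity) hoff).trans ?_⟩
  gcongr
  exact le_max_right _ _

end Proportions

theorem denominator_pos {ι : Type*} [Fintype ι] [Nonempty ι] (h : n ≤ d) (hd : 0 < d)
    {y : ι → Fin (2 * n)} {j : Fin n} (ha : a * (d : ℝ) ^ (-(1 / 20) : ℝ) ≤ dirFrac y j)
    (hC : a < C) :
    0 < (d : ℝ) ^ (2 / 5 : ℝ) - a * (d : ℝ) ^ (7 / 20 : ℝ) + C * (d : ℝ) ^ (-(1 / 20) : ℝ) := by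
  have hdiag := (le_avgDiag h y (Fin.castLE h j)).trans (avgDiag_castLE_le h y hd ha)
  have hs : 0 < (d : ℝ) ^ (-(1 / 20) : ℝ) := by positivity
  rw [mul_sub, mul_one, mul_assoc, rpow_neg_mul_rpow hd] at hdiag
  linarith [mul_lt_mul_of_pos_right hC hs]

section Typical

variable {h : n ≤ d} {w : Matrix (Fin m) (Fin d) ℝ}

theorem IsTypical.div_le_representability_of_localLoss {N : ℕ} {y : Fin N → Fin (2 * n)}
    {x : Fin N → EuclideanSpace ℝ (Fin d)} (hx : IsTypical h y x) (hd : 0 < d) (hnm : n ≤ m)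
    (hN : 0 < N) {k : Fin n} (hoff : (offClassCount k y : ℝ) ≤ A * (d : ℝ) ^ (-(4 / 5) : ℝ) * N)
    {π : Measure (EuclideanSpace ℝ (Fin m) × EuclideanSpace ℝ (Fin m))} (hπ : IsCenteredNoise π)
    (hw : IsLocalMin (localLoss π x) w) {i : Fin n} (hik : i ≠ k) (hA : 0 ≤ A) (hC : A + 2 ≤ C)
    (ε : Matrix (Fin m) (Fin d) ℝ) :
    ((d : ℝ) ^ (2 / 5 : ℝ) - C * (d : ℝ) ^ (-(2 / 5) : ℝ)
        + diagPerturbation w ε (Fin.castLE h i))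
      / ((d : ℝ) ^ (2 / 5 : ℝ) + C * (d : ℝ) ^ (-(2 / 5) : ℝ) + normPerturbation w ε)
      ≤ representability (w + ε) (Fin.castLE h i) := by
  have : NeZero n := ⟨k.pos.ne'⟩
  have : NeZero N := ⟨hN.ne'⟩
  have hτ : 0 < (d : ℝ) ^ (2 / 5 : ℝ) := by positivity
  have hμ : 0 < (d : ℝ) ^ (-(2 / 5) : ℝ) := by positivity
  have hμC := mul_le_mul_of_nonneg_right hC hμ.le
  have hAμ := mul_nonneg hA hμ.le
  refine hx.div_le_representability hd hnm (isLocalMin_gramLoss_of_localLoss hN hπ hw)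
    (dirFrac_nonneg y) (dirFrac_le_of_offClassCount_le hN hik hoff) ?_ ?_ ?_ ε
  · rw [mul_rpow_neg_mul_rpow hd]
    linarith
  · linarith
  · linarith

theorem IsTypical.div_le_representability_of_globalLoss [NeZero n] {N : Fin n → ℕ}
    {y : (k : Fin n) → Fin (N k) → Fin (2 * n)}
    {x : (k : Fin n) → Fin (N k) → EuclideanSpace ℝ (Fin d)}
    (hx : IsTypical h (fun p : (k : Fin n) × Fin (N k) => y p.1 p.2) fun p => x p.1 p.2)
    (hd : 0 < d) (hnm : n ≤ m) (hN : ∀ k, 0 < N k)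
    {π : Fin n → Measure (EuclideanSpace ℝ (Fin m) × EuclideanSpace ℝ (Fin m))}
    (hπ : ∀ k, IsCenteredNoise (π k)) (hw : IsLocalMin (globalLoss π x) w)
    (hlow : ∀ j, a * (d : ℝ) ^ (-(1 / 20) : ℝ)
      ≤ dirFrac (fun p : (k : Fin n) × Fin (N k) => y p.1 p.2) j) {i : Fin n}
    (hup : dirFrac (fun p : (k : Fin n) × Fin (N k) => y p.1 p.2) i
      ≤ b * (d : ℝ) ^ (-(1 / 20) : ℝ) + A * (d : ℝ) ^ (-(4 / 5) : ℝ))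
    (hA : 0 ≤ A) (ha : 0 ≤ a) (hC : A + a + 2 ≤ C) (ε : Matrix (Fin m) (Fin d) ℝ) :
    ((d : ℝ) ^ (2 / 5 : ℝ) - b * (d : ℝ) ^ (7 / 20 : ℝ) - C * (d : ℝ) ^ (-(1 / 20) : ℝ)
        - C * (d : ℝ) ^ (-(2 / 5) : ℝ) + diagPerturbation w ε (Fin.castLE h i))
      / ((d : ℝ) ^ (2 / 5 : ℝ) - a * (d : ℝ) ^ (7 / 20 : ℝ) + C * (d : ℝ) ^ (-(1 / 20) : ℝ)
        + normPerturbation w ε)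
      ≤ representability (w + ε) (Fin.castLE h i) := by
  have : Nonempty ((k : Fin n) × Fin (N k)) := ⟨⟨0, ⟨0, hN 0⟩⟩⟩
  have hμ : 0 ≤ (d : ℝ) ^ (-(2 / 5) : ℝ) := by positivity
  have hμs : (d : ℝ) ^ (-(2 / 5) : ℝ) ≤ (d : ℝ) ^ (-(1 / 20) : ℝ) :=
    Real.rpow_le_rpow_of_exponent_le (by exact_mod_cast hd) (by norm_num)
  have hCμ := mul_le_mul_of_nonneg_right hC hμ
  have hCs := mul_le_mul_of_nonneg_right hC (hμ.trans hμs)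
  have haμ := mul_nonneg ha hμ
  have hAs := mul_nonneg hA (hμ.trans hμs)
  have has := mul_nonneg ha (hμ.trans hμs)
  refine hx.div_le_representability hd hnm (isLocalMin_gramLoss_of_globalLoss hN hπ hw)
    hlow hup ?_ ?_ (denominator_pos h hd (hlow i) (by linarith)) ε
  · rw [add_mul, mul_rpow_neg_mul_rpow hd, mul_assoc b, rpow_neg_mul_rpow hd]
    linarith
  · rw [mul_sub, mul_one, mul_assoc a, rpow_neg_mul_rpow hd]
    linarith

end Typical

theorem measure_not_isTypical_sigma_le [NeZero n] {h : n ≤ d} {Ω : Type*} [MeasurableSpace Ω]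
    {P : Measure Ω} [IsProbabilityMeasure P] {N : Fin n → ℕ}
    {y : (k : Fin n) → Fin (N k) → Fin (2 * n)}
    {x : (k : Fin n) → Fin (N k) → Ω → EuclideanSpace ℝ (Fin d)} (hd : 0 < d)
    (hx : ∀ k s, HasLaw (x k s) (classLaw h (y k s)) P)
    (hind : Pairwise fun p q : (k : Fin n) × Fin (N k) => IndepFun (x p.1 p.2) (x q.1 q.2) P)
    (hn : (n : ℝ) ≤ c * (d : ℝ) ^ (1 / 20 : ℝ)) (hN : ∀ k, (d : ℝ) ^ (2 + γ) ≤ N k) :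
    P {ω | ¬ IsTypical h (fun p : (k : Fin n) × Fin (N k) => y p.1 p.2) fun p => x p.1 p.2 ω}
      ≤ ENNReal.ofReal (8 * (c ^ 4 + gaussianFourthMoment) * (d : ℝ) ^ (-γ)) := by
  have hN0 : (0 : ℝ) < N 0 := lt_of_lt_of_le (by positivity) (hN 0)
  have : Nonempty ((k : Fin n) × Fin (N k)) := ⟨⟨0, ⟨0, by exact_mod_cast hN0⟩⟩⟩
  have hcard : (d : ℝ) ^ (2 + γ) ≤ Fintype.card ((k : Fin n) × Fin (N k)) := by
    rw [Fintype.card_sigma, Nat.cast_sum]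
    simp only [Fintype.card_fin]
    exact (hN 0).trans (Finset.single_le_sum (f := fun k => (N k : ℝ))
      (fun k _ => Nat.cast_nonneg _) (Finset.mem_univ 0))
  exact measure_not_isTypical_le (y := fun p : (k : Fin n) × Fin (N k) => y p.1 p.2)
    (x := fun p => x p.1 p.2) hd (fun p => hx p.1 p.2) hind hn hcard

section Events

variable {Ω : Type*} [MeasurableSpace Ω] {P : Measure Ω} [IsProbabilityMeasure P] {h : n ≤ d}

theorem measure_not_representability_bounds_localLoss_le {N : ℕ} {y : Fin N → Fin (2 * n)}
    {x : Fin N → Ω → EuclideanSpace ℝ (Fin d)} (hd : 0 < d) (hnm : n ≤ m)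
    (hnc : (n : ℝ) ≤ c * (d : ℝ) ^ (1 / 20 : ℝ)) (hN : (d : ℝ) ^ (2 + γ) ≤ N)
    (hx : ∀ s, HasLaw (x s) (classLaw h (y s)) P)
    (hind : Pairwise fun s t => IndepFun (x s) (x t) P)
    {k : Fin n} (hoff : (offClassCount k y : ℝ) ≤ A * (d : ℝ) ^ (-(4 / 5) : ℝ) * N)
    {π : Measure (EuclideanSpace ℝ (Fin m) × EuclideanSpace ℝ (Fin m))} (hπ : IsCenteredNoise π)
    (hA : 0 ≤ A) (hC : A + 2 ≤ C) (hP : 8 * (c ^ 4 + gaussianFourthMoment) ≤ C) :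
    P {ω | ¬ ∀ w ε : Matrix (Fin m) (Fin d) ℝ, IsLocalMin (localLoss π fun s => x s ω) w →
        ∀ i : Fin n, i ≠ k →
          ((d : ℝ) ^ (2 / 5 : ℝ) - C * (d : ℝ) ^ (-(2 / 5) : ℝ)
              + diagPerturbation w ε (Fin.castLE h i))
            / ((d : ℝ) ^ (2 / 5 : ℝ) + C * (d : ℝ) ^ (-(2 / 5) : ℝ) + normPerturbation w ε)
            ≤ representability (w + ε) (Fin.castLE h i) ∧
          representability (w + ε) (Fin.castLE h i) ≤ 1}
      ≤ ENNReal.ofReal (C * (d : ℝ) ^ (-γ)) := by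
  have hN0 : 0 < N := Nat.cast_pos.1 (hN.trans_lt' (by positivity))
  have : Nonempty (Fin N) := ⟨⟨0, hN0⟩⟩
  calc P _ ≤ P {ω | ¬ IsTypical h y fun s => x s ω} :=
        measure_mono fun ω => mt fun hω w ε hw i hik =>
          ⟨hω.div_le_representability_of_localLoss hd hnm hN0 hoff hπ hw hik hA hC ε,
            representability_le_one _ _⟩
    _ ≤ ENNReal.ofReal (8 * (c ^ 4 + gaussianFourthMoment) * (d : ℝ) ^ (-γ)) :=
        measure_not_isTypical_le hd hx hind hnc (by rwa [Fintype.card_fin])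
    _ ≤ ENNReal.ofReal (C * (d : ℝ) ^ (-γ)) := by gcongr

theorem measure_not_representability_bounds_globalLoss_le [NeZero n] {N : Fin n → ℕ}
    {y : (k : Fin n) → Fin (N k) → Fin (2 * n)}
    {x : (k : Fin n) → Fin (N k) → Ω → EuclideanSpace ℝ (Fin d)} (hd : 0 < d) (hnm : n ≤ m)
    (hnc : (n : ℝ) ≤ c * (d : ℝ) ^ (1 / 20 : ℝ)) (hN : ∀ k, (d : ℝ) ^ (2 + γ) ≤ N k)
    (hx : ∀ k s, HasLaw (x k s) (classLaw h (y k s)) P)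
    (hind : Pairwise fun p q : (k : Fin n) × Fin (N k) => IndepFun (x p.1 p.2) (x q.1 q.2) P)
    (hfrac : ∀ j, a * (d : ℝ) ^ (-(1 / 20) : ℝ)
        ≤ dirFrac (fun p : (k : Fin n) × Fin (N k) => y p.1 p.2) j ∧
      dirFrac (fun p : (k : Fin n) × Fin (N k) => y p.1 p.2) j
        ≤ b * (d : ℝ) ^ (-(1 / 20) : ℝ) + A * (d : ℝ) ^ (-(4 / 5) : ℝ))
    {π : Fin n → Measure (EuclideanSpace ℝ (Fin m) × EuclideanSpace ℝ (Fin m))}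
    (hπ : ∀ k, IsCenteredNoise (π k)) (hA : 0 ≤ A) (ha : 0 ≤ a) (hC : A + a + 2 ≤ C)
    (hP : 8 * (c ^ 4 + gaussianFourthMoment) ≤ C) :
    P {ω | ¬ ∀ w ε : Matrix (Fin m) (Fin d) ℝ, IsLocalMin (globalLoss π fun k s => x k s ω) w →
        ∀ i : Fin n,
          ((d : ℝ) ^ (2 / 5 : ℝ) - b * (d : ℝ) ^ (7 / 20 : ℝ) - C * (d : ℝ) ^ (-(1 / 20) : ℝ)
              - C * (d : ℝ) ^ (-(2 / 5) : ℝ) + diagPerturbation w ε (Fin.castLE h i))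
            / ((d : ℝ) ^ (2 / 5 : ℝ) - a * (d : ℝ) ^ (7 / 20 : ℝ)
              + C * (d : ℝ) ^ (-(1 / 20) : ℝ) + normPerturbation w ε)
            ≤ representability (w + ε) (Fin.castLE h i) ∧
          representability (w + ε) (Fin.castLE h i) ≤ 1}
      ≤ ENNReal.ofReal (C * (d : ℝ) ^ (-γ)) := by
  have hN0 : ∀ k, 0 < N k := fun k => Nat.cast_pos.1 ((hN k).trans_lt' (by positivity))
  calc P _ ≤ P {ω | ¬ IsTypical h (fun p : (k : Fin n) × Fin (N k) => y p.1 p.2)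
          fun p => x p.1 p.2 ω} :=
        measure_mono fun ω => mt fun hω w ε hw i =>
          ⟨IsTypical.div_le_representability_of_globalLoss (x := fun k s => x k s ω) hω hd hnm hN0
            hπ hw (fun j => (hfrac j).1) (hfrac i).2 hA ha hC ε, representability_le_one _ _⟩
    _ ≤ ENNReal.ofReal (8 * (c ^ 4 + gaussianFourthMoment) * (d : ℝ) ^ (-γ)) :=
        measure_not_isTypical_sigma_le hd hx hind hnc hN
    _ ≤ ENNReal.ofReal (C * (d : ℝ) ^ (-γ)) := by gcongr

end Events

end RepresentabilityBounds

end FedSSL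

end

theorem theorem2_general (γ A c₁ c₂ b₁ b₂ : ℝ) (hc₁ : 0 < c₁) (hb₁ : 0 < b₁) :
    ∃ (a b C : ℝ) (d₀ : ℕ), 0 < a ∧ a ≤ b ∧ 0 < C ∧
      ∀ (d n m : ℕ) (hnd : n ≤ d), d₀ ≤ d → n ≤ m →
      c₁ * (d : ℝ) ^ (1 / 20 : ℝ) ≤ n → (n : ℝ) ≤ c₂ * (d : ℝ) ^ (1 / 20 : ℝ) →
      ∀ (N : Fin n → ℕ) (y : (k : Fin n) → Fin (N k) → Fin (2 * n)),
      (∀ k, (d : ℝ) ^ (2 + γ) ≤ N k) →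
      (∀ k, b₁ / n ≤ (N k : ℝ) / ∑ l, (N l : ℝ) ∧ (N k : ℝ) / ∑ l, (N l : ℝ) ≤ b₂ / n) →
      (∀ k, (FedSSL.offClassCount k (y k) : ℝ) ≤ A * (d : ℝ) ^ (-(4 / 5) : ℝ) * N k) →
      ∀ (π : Fin n → Measure (EuclideanSpace ℝ (Fin m) × EuclideanSpace ℝ (Fin m))),
      (∀ k, FedSSL.IsCenteredNoise (π k)) →
      ∀ {Ω : Type*} [MeasurableSpace Ω] (P : Measure Ω) [IsProbabilityMeasure P]
        (x : (k : Fin n) → Fin (N k) → Ω → EuclideanSpace ℝ (Fin d)),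
      (∀ k s, HasLaw (x k s) (FedSSL.classLaw hnd (y k s)) P) →
      Pairwise (fun p q : (k : Fin n) × Fin (N k) => IndepFun (x p.1 p.2) (x q.1 q.2) P) →
      (∀ k : Fin n,
        P {ω | ¬ ∀ w ε : Matrix (Fin m) (Fin d) ℝ,
            IsLocalMin (FedSSL.localLoss (π k) (fun s => x k s ω)) w →
            ∀ i : Fin n, i ≠ k →
              ((d : ℝ) ^ (2 / 5 : ℝ) - C * (d : ℝ) ^ (-(2 / 5) : ℝ)
                  + FedSSL.diagPerturbation w ε (Fin.castLE hnd i))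
                / ((d : ℝ) ^ (2 / 5 : ℝ) + C * (d : ℝ) ^ (-(2 / 5) : ℝ)
                  + FedSSL.normPerturbation w ε)
                ≤ FedSSL.representability (w + ε) (Fin.castLE hnd i) ∧
              FedSSL.representability (w + ε) (Fin.castLE hnd i) ≤ 1}
          ≤ ENNReal.ofReal (C * (d : ℝ) ^ (-γ))) ∧
      0 < (d : ℝ) ^ (2 / 5 : ℝ) - a * (d : ℝ) ^ (7 / 20 : ℝ) + C * (d : ℝ) ^ (-(1 / 20) : ℝ) ∧
      P {ω | ¬ ∀ w ε : Matrix (Fin m) (Fin d) ℝ,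
          IsLocalMin (FedSSL.globalLoss π (fun k s => x k s ω)) w →
          ∀ i : Fin n,
            ((d : ℝ) ^ (2 / 5 : ℝ) - b * (d : ℝ) ^ (7 / 20 : ℝ) - C * (d : ℝ) ^ (-(1 / 20) : ℝ)
                - C * (d : ℝ) ^ (-(2 / 5) : ℝ)
                + FedSSL.diagPerturbation w ε (Fin.castLE hnd i))
              / ((d : ℝ) ^ (2 / 5 : ℝ) - a * (d : ℝ) ^ (7 / 20 : ℝ)
                + C * (d : ℝ) ^ (-(1 / 20) : ℝ) + FedSSL.normPerturbation w ε)
              ≤ FedSSL.representability (w + ε) (Fin.castLE hnd i) ∧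
            FedSSL.representability (w + ε) (Fin.castLE hnd i) ≤ 1}
        ≤ ENNReal.ofReal (C * (d : ℝ) ^ (-γ)) := by
  obtain ⟨a, b, d₀, ha, hab, hd₀, hfrac⟩ :=
    FedSSL.exists_dirFrac_sigma_bounds (c₂ := c₂) (b₂ := b₂) (abs_nonneg A) hc₁ hb₁
  have hm := FedSSL.gaussianFourthMoment_nonneg
  have hK : 0 ≤ 8 * (c₂ ^ 4 + FedSSL.gaussianFourthMoment) := by positivity
  have hA := abs_nonneg A
  refine ⟨a, b, 8 * (c₂ ^ 4 + FedSSL.gaussianFourthMoment) + (|A| + a + 2), d₀, ha, hab,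
    by positivity, ?_⟩
  intro d n m hnd hd hnm hcn hnc N y hN hprop hoff π hπ Ω _ P _ x hx hind
  have hd0 : 0 < d := hd₀.trans_le hd
  have hN0 : ∀ k, 0 < N k := fun k => Nat.cast_pos.1 ((hN k).trans_lt' (by positivity))
  have : NeZero n := ⟨(Nat.cast_pos.1 (hcn.trans_lt' (by positivity))).ne'⟩
  have : Nonempty ((k : Fin n) × Fin (N k)) := ⟨⟨0, ⟨0, hN0 0⟩⟩⟩
  have hoff' := fun k => (hoff k).trans (mul_le_mul_of_nonneg_right
    (mul_le_mul_of_nonneg_right (le_abs_self A) (by positivity)) (by positivity))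
  have hdir := hfrac d n hd hcn hnc N y hN0 hprop hoff'
  exact ⟨fun k => FedSSL.measure_not_representability_bounds_localLoss_le hd0 hnm hnc (hN k) (hx k)
      (fun s t hst => hind fun e => hst (eq_of_heq (Sigma.mk.inj e).2)) (hoff' k) (hπ k) hA
      (by linarith) (by linarith),
    FedSSL.denominator_pos hnd hd0 (hdir 0).1 (by linarith),
    FedSSL.measure_not_representability_bounds_globalLoss_le hd0 hnm hnc hN hx hind hdir hπ hA
      ha.le (by linarith) (by linarith)⟩

theorem theorem2 (γ A c₁ c₂ b₁ b₂ : ℝ) (hγ : 0 < γ) (hc₁ : 0 < c₁) (hb₁ : 0 < b₁) :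
    ∃ (a b C : ℝ) (d₀ : ℕ), 0 < a ∧ a ≤ b ∧ 0 < C ∧
      ∀ (d n m : ℕ) (hnd : n ≤ d), d₀ ≤ d → n ≤ m →
      -- `n = Θ(d^{1/20})`
      c₁ * (d : ℝ) ^ (1 / 20 : ℝ) ≤ n → (n : ℝ) ≤ c₂ * (d : ℝ) ^ (1 / 20 : ℝ) →
      -- sizes `N k` of the local data sets and labels `y k` of their samples
      ∀ (N : Fin n → ℕ) (y : (k : Fin n) → Fin (N k) → Fin (2 * n)),
      (∀ k, (d : ℝ) ^ (2 + γ) ≤ N k) →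
      (∀ k, b₁ / n ≤ (N k : ℝ) / ∑ l, (N l : ℝ) ∧ (N k : ℝ) / ∑ l, (N l : ℝ) ≤ b₂ / n) →
      (∀ k, (FedSSL.offClassCount k (y k) : ℝ) ≤ A * (d : ℝ) ^ (-(4 / 5) : ℝ) * N k) →
      -- the noise in the objectives
      ∀ (π : Fin n → Measure (EuclideanSpace ℝ (Fin m) × EuclideanSpace ℝ (Fin m))),
      (∀ k, FedSSL.IsCenteredNoise (π k)) →
      -- the random data
      ∀ {Ω : Type*} [MeasurableSpace Ω] (P : Measure Ω) [IsProbabilityMeasure P]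
        (x : (k : Fin n) → Fin (N k) → Ω → EuclideanSpace ℝ (Fin d)),
      (∀ k s, HasLaw (x k s) (FedSSL.classLaw hnd (y k s)) P) →
      iIndepFun (fun p : (k : Fin n) × Fin (N k) => x p.1 p.2) P →
      -- the local models
      (∀ k : Fin n,
        P {ω | ¬ ∀ w ε : Matrix (Fin m) (Fin d) ℝ,
            FedSSL.IsOptimal (FedSSL.localLoss (π k) (fun s => x k s ω)) w →
            ∀ i : Fin n, i ≠ k →
              ((d : ℝ) ^ (2 / 5 : ℝ) - C * (d : ℝ) ^ (-(2 / 5) : ℝ)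
                  + FedSSL.diagPerturbation w ε (Fin.castLE hnd i))
                / ((d : ℝ) ^ (2 / 5 : ℝ) + C * (d : ℝ) ^ (-(2 / 5) : ℝ)
                  + FedSSL.normPerturbation w ε)
                ≤ FedSSL.representability (w + ε) (Fin.castLE hnd i) ∧
              FedSSL.representability (w + ε) (Fin.castLE hnd i) ≤ 1}
          ≤ ENNReal.ofReal (C * (d : ℝ) ^ (-γ))) ∧
      -- the global model (its denominator is positive)
      0 < (d : ℝ) ^ (2 / 5 : ℝ) - a * (d : ℝ) ^ (7 / 20 : ℝ) + C * (d : ℝ) ^ (-(1 / 20) : ℝ) ∧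
      P {ω | ¬ ∀ w ε : Matrix (Fin m) (Fin d) ℝ,
          FedSSL.IsOptimal (FedSSL.globalLoss π (fun k s => x k s ω)) w →
          ∀ i : Fin n,
            ((d : ℝ) ^ (2 / 5 : ℝ) - b * (d : ℝ) ^ (7 / 20 : ℝ) - C * (d : ℝ) ^ (-(1 / 20) : ℝ)
                - C * (d : ℝ) ^ (-(2 / 5) : ℝ)
                + FedSSL.diagPerturbation w ε (Fin.castLE hnd i))
              / ((d : ℝ) ^ (2 / 5 : ℝ) - a * (d : ℝ) ^ (7 / 20 : ℝ)
                + C * (d : ℝ) ^ (-(1 / 20) : ℝ) + FedSSL.normPerturbation w ε)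
              ≤ FedSSL.representability (w + ε) (Fin.castLE hnd i) ∧
            FedSSL.representability (w + ε) (Fin.castLE hnd i) ≤ 1}
        ≤ ENNReal.ofReal (C * (d : ℝ) ^ (-γ)) := by
  obtain ⟨a, b, C, d₀, ha, hab, hC, H⟩ := theorem2_general γ A c₁ c₂ b₁ b₂ hc₁ hb₁
  refine ⟨a, b, C, d₀, ha, hab, hC, ?_⟩
  intro d n m hnd hd hnm hcn hnc N y hN hprop hoff π hπ Ω _ P _ x hx hind
  obtain ⟨hlocal, hpos, hglobal⟩ := H d n m hnd hd hnm hcn hnc N y hN hprop hoff π hπ P x hx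
    fun p q hpq => hind.indepFun hpq
  refine ⟨fun k => (measure_mono fun ω => mt fun h w ε hw => h w ε ?_).trans (hlocal k), hpos,
    (measure_mono fun ω => mt fun h w ε hw => h w ε ?_).trans hglobal⟩
  all_goals exact .of_forall hw
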